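/- Let $d_1,d_2\ge 1$ and let $\mathbb P^{N_{d_i}}$ be the projective space of plane curves of degree $d_i$ over $\mathbb C$. Let $\mathcal X=\mathcal X_1\cup\mathcal X_2\subset\mathbb P^2\times\mathbb P^{N_{d_1}}\times\mathbb P^{N_{d_2}}$, where $\mathcal X_i$ is the universal curve $\sum_{|\alpha|=d_i}a^{(i)}_\alpha Z^\alpha=0$, $[Z]\in\mathbb P^2$, $[a^{(i)}]\in\mathbb P^{N_{d_i}}$. Let $\overline{J_2^v}(\mathbb P^2\times\mathbb P^{N_{d_1}}\times\mathbb P^{N_{d_2}})$ be the space of logarithmic $2$-jets of the log manifold $(\mathbb P^2\times\mathbb P^{N_{d_1}}\times\mathbb P^{N_{d_2}},\mathcal X)$ which are tangent to the fibres of the projection to $\mathbb P^{N_{d_1}}\times\mathbb P^{N_{d_2}}$, and let $p_2$ be its projection to $\mathbb P^2\times\mathbb P^{N_{d_1}}\times\mathbb P^{N_{d_2}}$. Let $U\subset\mathbb P^{N_{d_1}+1}\times\mathbb P^{N_{d_2}+1}$ be the set of all $([a^{(1)}:A_1],[a^{(2)}:A_2])$ with $A_i\neq0$ and $a^{(i)}\neq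 0$ for $i=1,2$, and let $\mathcal Y\subset\mathbb P^4\times U$ be defined by $$A_1Z_3^{d_1}+\sum_{|\alpha|=d_1}a^{(1)}_\alpha Z^\alpha=0,\qquad A_2Z_4^{d_2}+\sum_{|\alpha|=d_2}a^{(2)}_\alpha Z^\alpha=0$$ (with $Z^\alpha=Z_0^{\alpha_0}Z_1^{\alpha_1}Z_2^{\alpha_2}$), with the divisor $H=(Z_3Z_4=0)$. The projection $(\mathcal Y,H)\to(\mathbb P^2\times\mathbb P^{N_{d_1}}\times\mathbb P^{N_{d_2}},\mathcal X)$ induces a map $\pi_2$ from the space $\overline{J_2^v}(\mathcal Y)$ of vertical logarithmic $2$-jets of $(\mathcal Y,H)$ to $\overline{J_2^v}(\mathbb P^2\times\mathbb P^{N_{d_1}}\times\mathbb P^{N_{d_2}})$. Let $\Sigma\subset\overline{J_2^v}(\mathcal Y)$ be the closure of the set of jets over $Z_0\ne0$ with $\det(\xi^{(j)}_i)_{1\le i,j\le 2}=0$, where $\xi_i^{(j)}$ is the $j$-th derivative along the jet of the affine coordinate $z_i=Z_i/Z_0$. Then $$T_{\overline{J_2^v}(\mathbb P^2\times\mathbb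 P^{N_{d_1}}\times\mathbb P^{N_{d_2}})}\otimes\mathcal O_{\mathbb P^2}(7)\otimes\mathcal O_{\mathbb P^{N_{d_1}}}(*)\otimes\mathcal O_{\mathbb P^{N_{d_2}}}(*)$$ is generated by its global sections on $\overline{J_2^v}(\mathbb P^2\times\mathbb P^{N_{d_1}}\times\mathbb P^{N_{d_2}})\setminus(\pi_2(\Sigma)\cup p_2^{-1}(\mathcal X))$. That is, there are integers $m_1,m_2\ge0$ (depending only on $d_1,d_2$) such that at every point of this set the global algebraic (in particular holomorphic) sections of $T\otimes\mathcal O_{\mathbb P^2}(7)\otimes\mathcal O_{\mathbb P^{N_{d_1}}}(m_1)\otimes\mathcal O_{\mathbb P^{N_{d_2}}}(m_2)$ span the fibre. (Over $p_2^{-1}(\mathcal X)$, where the jet space may be singular, $T$ denotes the tangent sheaf.) -/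

import Mathlib

open MvPolynomial

noncomputable section

namespace LogJets

/-! ### Plane curves and 2-jets in homogeneous coordinates

The index `c : Fin 2` numbers the two components, `d c` is the degree of the component `c`. -/

/-- Exponents `α = (α₀, α₁, α₂)` with `|α| = d`, i.e. the coordinates on `ℂ ^ (N_d + 1)`. -/
abbrev Mon (d : ℕ) : Type :=
  {α : Fin 3 → ℕ // α ∈ Finset.piAntidiag (Finset.univ : Finset (Fin 3)) d}

/-- The form `∑_{|α| = d} a_α Z ^ α`. -/
def form {d : ℕ} (a : Mon d → ℂ) : MvPolynomial (Fin 3) ℂ :=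
  ∑ α : Mon d, C (a α) * ∏ i : Fin 3, X i ^ α.1 i

/-- A 2-jet of a curve `t ↦ Z(t)` in `ℂ³`: `z k i` is the `k`-th derivative of `Z_i` at `t = 0`. -/
abbrev Jet : Type := Fin 3 → Fin 3 → ℂ

/-- `F(Z(t))` at `t = 0`. -/
def jetVal (F : MvPolynomial (Fin 3) ℂ) (z : Jet) : ℂ := eval (z 0) F

/-- `d/dt F(Z(t))` at `t = 0`. -/
def jetDer (F : MvPolynomial (Fin 3) ℂ) (z : Jet) : ℂ :=
  ∑ j, eval (z 0) (pderiv j F) * z 1 j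

/-- `d²/dt² F(Z(t))` at `t = 0`. -/
def jetDer2 (F : MvPolynomial (Fin 3) ℂ) (z : Jet) : ℂ :=
  (∑ j, eval (z 0) (pderiv j F) * z 2 j) +
    ∑ j, ∑ k, eval (z 0) (pderiv k (pderiv j F)) * z 1 j * z 1 k

/-- The 2-jet of `l(t) Z(t)`, for a 2-jet `l = (l(0), l'(0), l''(0))` of a function. -/
def scaleJet (l : Fin 3 → ℂ) (z : Jet) : Jet :=
  ![l 0 • z 0, l 0 • z 1 + l 1 • z 0, l 0 • z 2 + (2 * l 1) • z 1 + l 2 • z 0]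

/-- `((log l)'(0), (log l)''(0))`. -/
def logJet (l : Fin 3 → ℂ) : Fin 2 → ℂ := ![l 1 / l 0, l 2 / l 0 - (l 1 / l 0) ^ 2]

/-- The 2-jet of `l m`. -/
def mulJet (l m : Fin 3 → ℂ) : Fin 3 → ℂ :=
  ![l 0 * m 0, l 0 * m 1 + l 1 * m 0, l 0 * m 2 + 2 * l 1 * m 1 + l 2 * m 0]

/-- The 2-jet of `1 / l`. -/
def invJet (l : Fin 3 → ℂ) : Fin 3 → ℂ :=
  ![1 / l 0, - l 1 / l 0 ^ 2, 2 * l 1 ^ 2 / l 0 ^ 3 - l 2 / l 0 ^ 2]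

/-- The constant jet `1`. -/
def oneJet : Fin 3 → ℂ := ![1, 0, 0]

theorem scaleJet_mul (l m : Fin 3 → ℂ) (z : Jet) :
    scaleJet (mulJet l m) z = scaleJet l (scaleJet m z) := by
  funext k i
  fin_cases k <;> simp [scaleJet, mulJet] <;> ring

theorem scaleJet_one (z : Jet) : scaleJet oneJet z = z := by
  funext k i
  fin_cases k <;> simp [scaleJet, oneJet]

theorem logJet_mul (l m : Fin 3 → ℂ) (hl : l 0 ≠ 0) (hm : m 0 ≠ 0) :
    logJet (mulJet l m) = logJet l + logJet m := by
  funext k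
  fin_cases k <;> simp [logJet, mulJet] <;> field_simp <;> ring

theorem logJet_one : logJet oneJet = 0 := by
  funext k
  fin_cases k <;> simp [logJet, oneJet]

theorem invJet_ne (l : Fin 3 → ℂ) (hl : l 0 ≠ 0) : invJet l 0 ≠ 0 := by
  simp [invJet, hl]

theorem mulJet_ne (l m : Fin 3 → ℂ) (hl : l 0 ≠ 0) (hm : m 0 ≠ 0) : mulJet l m 0 ≠ 0 := by
  simp [mulJet, hl, hm]

theorem invJet_mul (l : Fin 3 → ℂ) (hl : l 0 ≠ 0) : mulJet (invJet l) l = oneJet := by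
  funext k
  fin_cases k <;> simp [invJet, mulJet, oneJet] <;> field_simp <;> ring

/-! ### The space of vertical logarithmic 2-jets of `(ℙ² × ℙ^{N_{d₁}} × ℙ^{N_{d₂}}, 𝒳)` -/

/-- `ℙ²`. -/
abbrev Plane : Type := Projectivization ℂ (Fin 3 → ℂ)

/-- `ℙ² × ℙ^{N_{d₁}} × ℙ^{N_{d₂}}`. -/
abbrev Base (d : Fin 2 → ℕ) : Type :=
  Plane × ((c : Fin 2) → Projectivization ℂ (Mon (d c) → ℂ))

/-- The universal curve `𝒳_c`, the zero locus of `∑ a⁽ᶜ⁾_α Z ^ α`. -/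
def universalCurve (d : Fin 2 → ℕ) (c : Fin 2) : Set (Base d) :=
  {x | ∃ (z : Fin 3 → ℂ) (hz : z ≠ 0) (a : Mon (d c) → ℂ) (ha : a ≠ 0),
    x.1 = Projectivization.mk ℂ z hz ∧ x.2 c = Projectivization.mk ℂ a ha ∧ eval z (form a) = 0}

/-- `𝒳 = 𝒳₁ ∪ 𝒳₂`. -/
def universalFamily (d : Fin 2 → ℕ) : Set (Base d) := universalCurve d 0 ∪ universalCurve d 1

/-- Coordinates `(z, a, η)` of a vertical logarithmic 2-jet: `z` is the 2-jet of a lift `Z(t)` of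
the curve to `ℂ³ \ 0`, `a c` are the (constant) coefficients of the component `c`, and
`η c = ((log s_c)', (log s_c)'')` are the logarithmic coordinates of the jet along `𝒳_c`, where
`s_c = ∑ a⁽ᶜ⁾_α Z ^ α`. -/
abbrev Amb (d : Fin 2 → ℕ) : Type :=
  Jet × ((c : Fin 2) → Mon (d c) → ℂ) × (Fin 2 → Fin 2 → ℂ)

/-- `s' = s (log s)'`. -/
def eqOne (d : Fin 2 → ℕ) (c : Fin 2) (p : Amb d) : ℂ :=
  jetDer (form (p.2.1 c)) p.1 - jetVal (form (p.2.1 c)) p.1 * p.2.2 c 0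

/-- `s'' = s ((log s)'' + ((log s)')²)`. -/
def eqTwo (d : Fin 2 → ℕ) (c : Fin 2) (p : Amb d) : ℂ :=
  jetDer2 (form (p.2.1 c)) p.1 -
    jetVal (form (p.2.1 c)) p.1 * (p.2.2 c 1 + p.2.2 c 0 ^ 2)

/-- The vertical logarithmic 2-jets, in homogeneous coordinates. -/
def cone (d : Fin 2 → ℕ) : Set (Amb d) :=
  {p | p.1 0 ≠ 0 ∧ (∀ c, p.2.1 c ≠ 0) ∧ ∀ c, eqOne d c p = 0 ∧ eqTwo d c p = 0}

/-- Change of homogeneous coordinates: `Z(t)` becomes `l(t) Z(t)` and `a c` becomes `μ c • a c`, so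
that `log s_c` becomes `log s_c + d_c log l + const`. -/
def act (d : Fin 2 → ℕ) (l : Fin 3 → ℂ) (μ : Fin 2 → ℂ) (p : Amb d) : Amb d :=
  (scaleJet l p.1, fun c => μ c • p.2.1 c, fun c => p.2.2 c + (d c : ℂ) • logJet l)

theorem act_act (d : Fin 2 → ℕ) (l m : Fin 3 → ℂ) (μ ν : Fin 2 → ℂ) (hl : l 0 ≠ 0) (hm : m 0 ≠ 0)
    (p : Amb d) : act d l μ (act d m ν p) = act d (mulJet l m) (μ * ν) p := by
  simp only [act, scaleJet_mul, logJet_mul l m hl hm, Pi.mul_apply, smul_smul, Prod.mk.injEq,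
    true_and]
  funext c
  simp only [smul_add]
  abel

theorem act_one (d : Fin 2 → ℕ) (p : Amb d) : act d oneJet 1 p = p := by
  simp [act, scaleJet_one, logJet_one]

/-- Two systems of homogeneous coordinates represent the same jet. -/
instance jetSetoid (d : Fin 2 → ℕ) : Setoid (cone d) where
  r p q := ∃ l : Fin 3 → ℂ, l 0 ≠ 0 ∧ ∃ μ : Fin 2 → ℂ, (∀ c, μ c ≠ 0) ∧ q.1 = act d l μ p.1
  iseqv := by
    refine ⟨fun p => ⟨oneJet, by simp [oneJet], 1, by simp, (act_one d p.1).symm⟩, ?_, ?_⟩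
    · rintro p q ⟨l, hl, μ, hμ, h⟩
      refine ⟨invJet l, invJet_ne l hl, μ⁻¹, by simpa using hμ, ?_⟩
      have h1 : μ⁻¹ * μ = 1 := by funext c; simp [hμ c]
      rw [h, act_act d _ _ _ _ (invJet_ne l hl) hl, invJet_mul l hl, h1, act_one]
    · rintro p q r ⟨l, hl, μ, hμ, h⟩ ⟨m, hm, ν, hν, h'⟩
      refine ⟨mulJet m l, mulJet_ne m l hm hl, ν * μ, fun c => mul_ne_zero (hν c) (hμ c), ?_⟩
      rw [h', h, act_act d _ _ _ _ hm hl]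

/-- The space of vertical logarithmic 2-jets `J̄₂ᵛ(ℙ² × ℙ^{N_{d₁}} × ℙ^{N_{d₂}})` along `𝒳`. -/
abbrev LogJetSpace (d : Fin 2 → ℕ) : Type := Quotient (jetSetoid d)

/-- The projection `p₂` to `ℙ² × ℙ^{N_{d₁}} × ℙ^{N_{d₂}}`. -/
def pTwo (d : Fin 2 → ℕ) : LogJetSpace d → Base d :=
  Quotient.lift
    (fun p => (Projectivization.mk ℂ (p.1.1 0) p.2.1,
      fun c => Projectivization.mk ℂ (p.1.2.1 c) (p.2.2.1 c))) (by
    rintro p q ⟨l, hl, μ, hμ, h⟩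
    refine Prod.ext ?_ (funext fun c => ?_)
    · refine ((Projectivization.mk_eq_mk_iff' ℂ _ _ q.2.1 p.2.1).2 ⟨l 0, ?_⟩).symm
      rw [h]; simp [act, scaleJet]
    · refine ((Projectivization.mk_eq_mk_iff' ℂ _ _ (q.2.2.1 c) (p.2.2.1 c)).2 ⟨μ c, ?_⟩).symm
      rw [h]; simp [act])

/-! ### The covering `𝒴`, its logarithmic jets and the exceptional set `Σ`

`𝒴 ⊂ ℙ⁴ × U` is given by `A_c Z_{3+c} ^ {d_c} + ∑ a⁽ᶜ⁾_α Z ^ α = 0` (`c = 0, 1`), where `A_c ≠ 0`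
and `a⁽ᶜ⁾ ≠ 0`; its divisor is `H = (Z₃ Z₄ = 0)`. -/

/-- Coordinates `(z, y, ζ, a, A)` of a vertical logarithmic 2-jet of `(𝒴, H)`: `z` is the 2-jet of
`(Z₀, Z₁, Z₂)`, `y c` is the value of `Z_{3+c}` and `ζ c` are the first two derivatives of
`log Z_{3+c}`. -/
abbrev AmbY (d : Fin 2 → ℕ) : Type :=
  Jet × (Fin 2 → ℂ) × (Fin 2 → Fin 2 → ℂ) × ((c : Fin 2) → Mon (d c) → ℂ) × (Fin 2 → ℂ)

/-- The vertical logarithmic 2-jets of `(𝒴, H)`, in homogeneous coordinates: the equations say that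
`A_c Z_{3+c} ^ {d_c} + ∑ a⁽ᶜ⁾_α Z ^ α` vanishes to second order along the jet. -/
def coneY (d : Fin 2 → ℕ) : Set (AmbY d) :=
  {q | ¬ (q.1 0 = 0 ∧ q.2.1 = 0) ∧ (∀ c, q.2.2.2.1 c ≠ 0) ∧ (∀ c, q.2.2.2.2 c ≠ 0) ∧
    ∀ c,
      q.2.2.2.2 c * q.2.1 c ^ d c + jetVal (form (q.2.2.2.1 c)) q.1 = 0 ∧
      q.2.2.2.2 c * q.2.1 c ^ d c * (d c * q.2.2.1 c 0) + jetDer (form (q.2.2.2.1 c)) q.1 = 0 ∧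
      q.2.2.2.2 c * q.2.1 c ^ d c * (d c * q.2.2.1 c 1 + (d c * q.2.2.1 c 0) ^ 2) +
        jetDer2 (form (q.2.2.2.1 c)) q.1 = 0}

/-- Change of homogeneous coordinates on `ℙ⁴` (along the jet) and on the parameter spaces. -/
def actY (d : Fin 2 → ℕ) (l : Fin 3 → ℂ) (μ : Fin 2 → ℂ) (q : AmbY d) : AmbY d :=
  (scaleJet l q.1, l 0 • q.2.1, fun c => q.2.2.1 c + logJet l, fun c => μ c • q.2.2.2.1 c,
    μ * q.2.2.2.2)

theorem actY_actY (d : Fin 2 → ℕ) (l m : Fin 3 → ℂ) (μ ν : Fin 2 → ℂ) (hl : l 0 ≠ 0)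
    (hm : m 0 ≠ 0) (q : AmbY d) : actY d l μ (actY d m ν q) = actY d (mulJet l m) (μ * ν) q := by
  have h0 : mulJet l m 0 = l 0 * m 0 := by simp [mulJet]
  simp only [actY, scaleJet_mul, logJet_mul l m hl hm, Pi.mul_apply, smul_smul, Prod.mk.injEq,
    true_and, h0, mul_assoc, and_true]
  funext c
  abel

theorem actY_one (d : Fin 2 → ℕ) (q : AmbY d) : actY d oneJet 1 q = q := by
  have h0 : oneJet 0 = 1 := by simp [oneJet]
  simp [actY, scaleJet_one, logJet_one, h0]

/-- Two systems of homogeneous coordinates represent the same jet. -/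
instance jetSetoidY (d : Fin 2 → ℕ) : Setoid (coneY d) where
  r p q := ∃ l : Fin 3 → ℂ, l 0 ≠ 0 ∧ ∃ μ : Fin 2 → ℂ, (∀ c, μ c ≠ 0) ∧ q.1 = actY d l μ p.1
  iseqv := by
    refine ⟨fun p => ⟨oneJet, by simp [oneJet], 1, by simp, (actY_one d p.1).symm⟩, ?_, ?_⟩
    · rintro p q ⟨l, hl, μ, hμ, h⟩
      refine ⟨invJet l, invJet_ne l hl, μ⁻¹, by simpa using hμ, ?_⟩
      have h1 : μ⁻¹ * μ = 1 := by funext c; simp [hμ c]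
      rw [h, actY_actY d _ _ _ _ (invJet_ne l hl) hl, invJet_mul l hl, h1, actY_one]
    · rintro p q r ⟨l, hl, μ, hμ, h⟩ ⟨m, hm, ν, hν, h'⟩
      refine ⟨mulJet m l, mulJet_ne m l hm hl, ν * μ, fun c => mul_ne_zero (hν c) (hμ c), ?_⟩
      rw [h', h, actY_actY d _ _ _ _ hm hl]

/-- The space `J̄₂ᵛ(𝒴)`, with its quotient topology. -/
abbrev LogJetSpaceY (d : Fin 2 → ℕ) : Type := Quotient (jetSetoidY d)

theorem eval_zero_form {d : ℕ} (hd : 1 ≤ d) (a : Mon d → ℂ) : eval 0 (form a) = 0 := by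
  simp only [form, map_sum, map_mul, eval_C, map_prod, map_pow, eval_X, Pi.zero_apply]
  refine Finset.sum_eq_zero fun α _ => ?_
  have hα : ∑ i, α.1 i = d := (Finset.mem_piAntidiag.1 α.2).1
  obtain ⟨i, hi⟩ : ∃ i, α.1 i ≠ 0 := by
    by_contra! h
    simp [h] at hα
    omega
  rw [Finset.prod_eq_zero (Finset.mem_univ i) (zero_pow hi), mul_zero]

/-- The map on coordinates induced by the projection `𝒴 → ℙ² × ℙ^{N_{d₁}} × ℙ^{N_{d₂}}`; as
`s_c = - A_c Z_{3+c} ^ {d_c}`, the derivatives of `log s_c` are `d_c` times those of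
`log Z_{3+c}`. -/
def piAmb (d : Fin 2 → ℕ) (q : AmbY d) : Amb d :=
  (q.1, q.2.2.2.1, fun c => (d c : ℂ) • q.2.2.1 c)

theorem piAmb_mem (d : Fin 2 → ℕ) (hd : ∀ c, 1 ≤ d c) {q : AmbY d} (hq : q ∈ coneY d) :
    piAmb d q ∈ cone d := by
  obtain ⟨h0, ha, hA, h⟩ := hq
  refine ⟨fun hz => h0 ⟨hz, ?_⟩, ha, fun c => ?_⟩
  · funext c
    have h1 := (h c).1
    have hz' : q.1 0 = 0 := hz
    rw [jetVal, hz', eval_zero_form (hd c), add_zero] at h1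
    have h2 := (mul_eq_zero.1 h1).resolve_left (hA c)
    exact pow_eq_zero_iff (by have := hd c; omega) |>.1 h2
  · obtain ⟨h1, h2, h3⟩ := h c
    constructor
    · simp only [eqOne, piAmb, Pi.smul_apply, smul_eq_mul]
      linear_combination h2 - (d c * q.2.2.1 c 0) * h1
    · simp only [eqTwo, piAmb, Pi.smul_apply, smul_eq_mul]
      linear_combination h3 - (d c * q.2.2.1 c 1 + (d c * q.2.2.1 c 0) ^ 2) * h1

/-- The induced map `π₂ : J̄₂ᵛ(𝒴) → J̄₂ᵛ(ℙ² × ℙ^{N_{d₁}} × ℙ^{N_{d₂}})`. -/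
def piTwo (d : Fin 2 → ℕ) (hd : ∀ c, 1 ≤ d c) : LogJetSpaceY d → LogJetSpace d :=
  Quotient.map (fun q => ⟨piAmb d q.1, piAmb_mem d hd q.2⟩) (by
    rintro p q ⟨l, hl, μ, hμ, h⟩
    refine ⟨l, hl, μ, hμ, ?_⟩
    simp [h, piAmb, actY, act])

/-- `Σ₀ = {det (ξ_i⁽ʲ⁾)_{1 ≤ i, j ≤ 2} = 0}` over `Z₀ ≠ 0`, where `ξ_i⁽ʲ⁾` are the derivatives of the
affine coordinates `z_i = Z_i / Z₀`. -/
def sigmaZero (d : Fin 2 → ℕ) : Set (LogJetSpaceY d) :=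
  {y | ∃ q : coneY d, y = Quotient.mk (jetSetoidY d) q ∧
    q.1.1 0 0 = 1 ∧ q.1.1 1 0 = 0 ∧ q.1.1 2 0 = 0 ∧
    q.1.1 1 1 * q.1.1 2 2 - q.1.1 2 1 * q.1.1 1 2 = 0}

/-- `Σ`, the closure of `Σ₀` in `J̄₂ᵛ(𝒴)`. -/
def sigma (d : Fin 2 → ℕ) : Set (LogJetSpaceY d) := closure (sigmaZero d)

/-! ### Affine charts and sections of `T ⊗ 𝒪_{ℙ²}(e) ⊗ 𝒪_{ℙ^{N_{d₁}}}(m₁) ⊗ 𝒪_{ℙ^{N_{d₂}}}(m₂)` -/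

/-- A chart `(i, γ)`: the open set `Z_i ≠ 0`, `a⁽ᶜ⁾_{γ c} ≠ 0` (`c = 0, 1`). -/
abbrev Chart (d : Fin 2 → ℕ) : Type := Fin 3 × ((c : Fin 2) → Mon (d c))

/-- The chart `(i, γ)` as a closed algebraic subset of an affine space: the jets whose coordinates
are normalized by `Z_i(t) ≡ 1` and `a⁽ᶜ⁾_{γ c} = 1`. -/
def slice (d : Fin 2 → ℕ) (χ : Chart d) : Set (Amb d) :=
  {p | p ∈ cone d ∧ p.1 0 χ.1 = 1 ∧ p.1 1 χ.1 = 0 ∧ p.1 2 χ.1 = 0 ∧ ∀ c, p.2.1 c (χ.2 c) = 1}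

/-- The homogeneous coordinates of the points of the chart. -/
def domain (d : Fin 2 → ℕ) (χ : Chart d) : Set (Amb d) :=
  {p | p.1 0 χ.1 ≠ 0 ∧ ∀ c, p.2.1 c (χ.2 c) ≠ 0}

/-- Normalization of homogeneous coordinates in the chart `χ`; restricted to another chart it is the
change of charts. -/
def normalize (d : Fin 2 → ℕ) (χ : Chart d) (p : Amb d) : Amb d :=
  act d (invJet fun k => p.1 k χ.1) (fun c => (p.2.1 c (χ.2 c))⁻¹) p

/-- The tangent space of the chart `χ` at one of its points `p`: the kernel of the differentials of
the defining equations. -/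
def tangentSpace (d : Fin 2 → ℕ) (χ : Chart d) (p : Amb d) : Set (Amb d) :=
  {v | (∀ k, v.1 k χ.1 = 0) ∧ (∀ c, v.2.1 c (χ.2 c) = 0) ∧
    ∀ c, fderiv ℂ (eqOne d c) p v = 0 ∧ fderiv ℂ (eqTwo d c) p v = 0}

/-- The polynomial functions on a vector space: the algebra generated by the linear forms. -/
def polyFun (E : Type*) [AddCommGroup E] [Module ℂ E] : Subalgebra ℂ (E → ℂ) :=
  Algebra.adjoin ℂ (Set.range fun φ : Module.Dual ℂ E => (φ : E → ℂ))

/-- A global (algebraic, in particular holomorphic) section of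
`T ⊗ 𝒪_{ℙ²}(e) ⊗ 𝒪_{ℙ^{N_{d₁}}}(m₁) ⊗ 𝒪_{ℙ^{N_{d₂}}}(m₂)` on `J̄₂ᵛ`, given in every chart `χ = (i, γ)`
by a vector field (its coefficient with respect to the generator
`Z_i ^ e · ∏_c (a⁽ᶜ⁾_{γ c}) ^ {m_c}` of the line bundle). -/
structure TwistedVectorField (d : Fin 2 → ℕ) (e : ℕ) (m : Fin 2 → ℕ) where
  /-- The local expressions. -/
  toFun : Chart d → Amb d → Amb d
  /-- Their components are regular functions on the chart. -/
  regular : ∀ χ, ∀ φ : Module.Dual ℂ (Amb d), ∃ P ∈ polyFun (Amb d),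
    ∀ p ∈ slice d χ, φ (toFun χ p) = P p
  /-- They are tangent to the chart. -/
  tangent : ∀ χ, ∀ p ∈ slice d χ, toFun χ p ∈ tangentSpace d χ p
  /-- They are compatible with the changes of charts. -/
  compat : ∀ χ χ', ∀ p ∈ slice d χ, p ∈ domain d χ' →
    fderiv ℂ (normalize d χ') p (toFun χ p) =
      (p.1 0 χ'.1 ^ e * ∏ c, p.2.1 c (χ'.2 c) ^ m c) • toFun χ' (normalize d χ' p)

/-- The twisted tangent bundle is generated by its global sections at the point `x`: in each chart
around `x`, every tangent vector at `x` is the value of a global section. -/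
def GeneratedAt (d : Fin 2 → ℕ) (e : ℕ) (m : Fin 2 → ℕ) (x : LogJetSpace d) : Prop :=
  ∀ (χ : Chart d) (p : Amb d) (hp : p ∈ slice d χ), Quotient.mk (jetSetoid d) ⟨p, hp.1⟩ = x →
    ∀ v ∈ tangentSpace d χ p, ∃ V : TwistedVectorField d e m, V.toFun χ p = v

end LogJets

end

noncomputable section

namespace LogJets

/-! ### The 2-jet of a polynomial along a jet -/

/-! Global sections come from polynomial vector fields in the homogeneous coordinates `(z, a, η)`
that are tangent to `cone` and equivariant under `act`, with weight `e` in the scaling of `Z` and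
weight `0` in the scaling of the coefficients. Projected to each chart by the differential of
`normalize`, such a field is a section twisted by `e` on `ℙ²` only (`toTwistedVectorField`), so `m =
0` suffices.

Two kinds of fields are enough. A matrix `M` moves the whole jet of `Z` by `M` and the coefficients
contragrediently; the jets of the `s_c` do not change to first order, so `η` stays fixed
(`linearLift_mem`). Where `det (Z, Z', Z'') ≠ 0` these fields reach every value of the jet
component.

Vertical fields change the coefficients of one component by a form `B` and compensate in `η`.
Tangency requires the variation of `η` to involve `B/s`, which is polynomial only for special `B`.
With `u = Z(0)`, `ℓ_j = u_k X_j - u_j X_k` and `D_u` the polar, the usable forms are `F`, `D_u F ·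
ℓ_j`, `D_u² F · ℓ_i ℓ_j`, and `G · ℓ_i ℓ_j ℓ_l` with `G` arbitrary: Euler's relation extracts the
factor `s` from the first three, and the last has zero 2-jet. Their weights are `0, 2, 4, 3`; powers
of a coordinate of `Z` raise them to `7`. If `F(u) ≠ 0`, filtering by the order of vanishing at `u`
shows that these forms span all forms of degree `d_c` (`mem_of_polar_mem`). Since `s_c ≠ 0`,
tangency then determines the `η` component (`exists_equivariantField`).

It remains to see that a jet off `𝒳` with `det (Z, Z', Z'') = 0` lies in `π₂(Σ)`
(`mem_piTwo_image_sigma`). It has an explicit lift to `𝒴`; over `Z₀ = 0` a small column operation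
makes `Z₀` nonzero while keeping the determinant zero, which places the lift in the closure. -/

/-- The 2-jet `(F, F', F'')` of `F(Z(t))`. -/
def jets (F : MvPolynomial (Fin 3) ℂ) (z : Jet) : Fin 3 → ℂ :=
  ![jetVal F z, jetDer F z, jetDer2 F z]

theorem jets_add (F G : MvPolynomial (Fin 3) ℂ) (z : Jet) :
    jets (F + G) z = jets F z + jets G z := by
  funext k
  fin_cases k <;> simp [jets, jetVal, jetDer, jetDer2, Fin.sum_univ_three] <;> ring

theorem jets_C (r : ℂ) (z : Jet) : jets (C r) z = ![r, 0, 0] := by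
  funext k
  fin_cases k <;> simp [jets, jetVal, jetDer, jetDer2]

theorem jets_X (i : Fin 3) (z : Jet) : jets (X i) z = fun k => z k i := by
  funext k
  fin_cases k <;>
    simp [jets, jetVal, jetDer, jetDer2, pderiv_X, Pi.single_apply, apply_ite (eval (z 0)),
      apply_ite (pderiv _)]

/-- Leibniz's rule. Together with additivity it reduces every later jet computation to constants and
variables, with no second partial derivatives to handle. -/
theorem jets_mul (F G : MvPolynomial (Fin 3) ℂ) (z : Jet) :
    jets (F * G) z = mulJet (jets F z) (jets G z) := by
  funext k
  fin_cases k <;>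
    simp [jets, mulJet, jetVal, jetDer, jetDer2, Fin.sum_univ_three, Derivation.leibniz] <;> ring

theorem jets_smul (r : ℂ) (F : MvPolynomial (Fin 3) ℂ) (z : Jet) :
    jets (r • F) z = r • jets F z := by
  rw [smul_eq_C_mul, jets_mul, jets_C]
  funext k
  fin_cases k <;> simp [mulJet]

theorem jets_zero (z : Jet) : jets 0 z = 0 := by
  simpa using jets_smul 0 0 z

theorem jets_neg (F : MvPolynomial (Fin 3) ℂ) (z : Jet) : jets (-F) z = - jets F z := by
  simpa using jets_smul (-1) F z

theorem jets_sum {ι : Type*} (s : Finset ι) (F : ι → MvPolynomial (Fin 3) ℂ) (z : Jet) :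
    jets (∑ i ∈ s, F i) z = ∑ i ∈ s, jets (F i) z := by
  classical
  induction s using Finset.induction_on with
  | empty => simp [jets_zero]
  | insert a s ha ih => rw [Finset.sum_insert ha, Finset.sum_insert ha, jets_add, ih]

/-- The 2-jet of `l ^ n`. -/
def powJet (l : Fin 3 → ℂ) (n : ℕ) : Fin 3 → ℂ :=
  ![l 0 ^ n, l 0 ^ n * (n * (l 1 / l 0)),
    l 0 ^ n * (n * (l 2 / l 0) + n * (n - 1) * (l 1 / l 0) ^ 2)]

theorem powJet_add (l : Fin 3 → ℂ) (n m : ℕ) :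
    powJet l (n + m) = mulJet (powJet l n) (powJet l m) := by
  funext k
  fin_cases k <;> simp [powJet, mulJet, pow_add] <;> ring

theorem powJet_one (l : Fin 3 → ℂ) (hl : l 0 ≠ 0) : powJet l 1 = l := by
  funext k
  fin_cases k <;> simp [powJet] <;> field_simp

theorem powJet_zero (l : Fin 3 → ℂ) : powJet l 0 = oneJet := by
  funext k
  fin_cases k <;> simp [powJet, oneJet]

/-- `F(l(t) Z(t)) = l(t) ^ n F(Z(t))` to second order. -/
def ScalesBy (l : Fin 3 → ℂ) (n : ℕ) (F : MvPolynomial (Fin 3) ℂ) : Prop :=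
  ∀ z, jets F (scaleJet l z) = mulJet (powJet l n) (jets F z)

theorem ScalesBy.mul {l : Fin 3 → ℂ} {n m : ℕ} {F G : MvPolynomial (Fin 3) ℂ}
    (hF : ScalesBy l n F) (hG : ScalesBy l m G) : ScalesBy l (n + m) (F * G) := by
  intro z
  rw [jets_mul, jets_mul, hF z, hG z, powJet_add]
  funext k
  fin_cases k <;> simp [mulJet] <;> ring

theorem scalesBy_C (l : Fin 3 → ℂ) (r : ℂ) : ScalesBy l 0 (C r) := by
  intro z
  rw [jets_C, jets_C, powJet_zero]
  funext k
  fin_cases k <;> simp [mulJet, oneJet]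

theorem scalesBy_X {l : Fin 3 → ℂ} (hl : l 0 ≠ 0) (i : Fin 3) : ScalesBy l 1 (X i) := by
  intro z
  rw [jets_X, jets_X, powJet_one l hl]
  funext k
  fin_cases k <;> simp [mulJet, scaleJet]

theorem ScalesBy.pow {l : Fin 3 → ℂ} {n : ℕ} {F : MvPolynomial (Fin 3) ℂ}
    (hF : ScalesBy l n F) (m : ℕ) : ScalesBy l (n * m) (F ^ m) := by
  induction m with
  | zero => simpa using scalesBy_C l 1
  | succ m ih => simpa [pow_succ, Nat.mul_succ] using ih.mul hF

theorem ScalesBy.sum {l : Fin 3 → ℂ} {n : ℕ} {ι : Type*} {s : Finset ι}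
    {F : ι → MvPolynomial (Fin 3) ℂ} (h : ∀ i ∈ s, ScalesBy l n (F i)) :
    ScalesBy l n (∑ i ∈ s, F i) := by
  intro z
  rw [jets_sum, jets_sum, Finset.sum_congr rfl fun i hi => h i hi z]
  funext k
  fin_cases k <;> simp [mulJet, Finset.sum_add_distrib, Finset.mul_sum]

/-- Scaling degrees add under products, so the constants and the variables suffice. -/
theorem scalesBy_form {l : Fin 3 → ℂ} (hl : l 0 ≠ 0) {d : ℕ} (a : Mon d → ℂ) :
    ScalesBy l d (form a) := by
  refine ScalesBy.sum fun α _ => ?_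
  have hα : ∑ i, α.1 i = d := (Finset.mem_piAntidiag.1 α.2).1
  rw [Fin.sum_univ_three] at hα
  rw [Fin.prod_univ_three]
  have h i := (scalesBy_X hl i).pow (α.1 i)
  have := (scalesBy_C l (a α)).mul (((h 0).mul (h 1)).mul (h 2))
  simpa [hα] using this

/-! ### Forms and their coefficients -/

/-- The coefficients of a polynomial at the monomials of degree `d`. -/
def coefs (d : ℕ) : MvPolynomial (Fin 3) ℂ →ₗ[ℂ] Mon d → ℂ :=
  LinearMap.pi fun α => lcoeff ℂ (Finsupp.equivFunOnFinite.symm α.1)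

theorem prod_X_pow_eq (α : Fin 3 → ℕ) :
    (∏ i, X i ^ α i : MvPolynomial (Fin 3) ℂ) = monomial (Finsupp.equivFunOnFinite.symm α) 1 := by
  rw [monomial_eq, Finsupp.prod_fintype _ _ (by simp)]
  simp

theorem coeff_form {d : ℕ} (a : Mon d → ℂ) (m : Fin 3 →₀ ℕ) :
    coeff m (form a) = ∑ α : Mon d, if Finsupp.equivFunOnFinite.symm α.1 = m then a α else 0 := by
  simp [form, prod_X_pow_eq, coeff_sum, coeff_C_mul, coeff_monomial]

theorem coefs_form {d : ℕ} (a : Mon d → ℂ) : coefs d (form a) = a := by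
  funext α
  simp [coefs, coeff_form]

theorem form_coefs {d : ℕ} {F : MvPolynomial (Fin 3) ℂ} (hF : F.IsHomogeneous d) :
    form (coefs d F) = F := by
  ext m
  rw [coeff_form]
  by_cases hm : coeff m F = 0
  · rw [hm]
    refine Finset.sum_eq_zero fun α _ => ?_
    split_ifs with h
    · simp [coefs, h, hm]
    · rfl
  · have h1 := hF hm
    have h2 : (m : Fin 3 → ℕ) ∈ Finset.piAntidiag (Finset.univ : Finset (Fin 3)) d := by
      rw [Finset.mem_piAntidiag]
      refine ⟨?_, by simp⟩
      rw [← h1, Finsupp.weight_apply, Finsupp.sum_fintype _ _ (by simp)]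
      simp
    rw [Finset.sum_eq_single (⟨m, h2⟩ : Mon d)]
    · simp [coefs]
    · intro α _ hα
      rw [if_neg]
      intro h
      apply hα
      apply Subtype.ext
      simp [← h]
    · simp

theorem form_isHomogeneous {d : ℕ} (a : Mon d → ℂ) : (form a).IsHomogeneous d := by
  refine IsHomogeneous.sum _ _ _ fun α _ => ?_
  have hα : ∑ i, α.1 i = d := (Finset.mem_piAntidiag.1 α.2).1
  have := (isHomogeneous_C (Fin 3) (a α)).mul
    (IsHomogeneous.prod Finset.univ (fun i => (X i ^ α.1 i : MvPolynomial (Fin 3) ℂ)) (fun i => α.1 i)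
      fun i _ => by simpa using (isHomogeneous_X ℂ i).pow (α.1 i))
  simpa [hα] using this

/-- `form` as a linear map. -/
def formLin (d : ℕ) : (Mon d → ℂ) →ₗ[ℂ] MvPolynomial (Fin 3) ℂ where
  toFun := form
  map_add' a b := by simp [form, add_mul, Finset.sum_add_distrib]
  map_smul' r a := by simp [form, smul_eq_C_mul, Finset.mul_sum, mul_assoc]

theorem form_add {d : ℕ} (a b : Mon d → ℂ) : form (a + b) = form a + form b :=
  (formLin d).map_add a b

theorem form_smul {d : ℕ} (r : ℂ) (a : Mon d → ℂ) : form (r • a) = r • form a :=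
  (formLin d).map_smul r a

/-! ### Regular maps -/

section Regular

variable {V E F G : Type*} [AddCommGroup V] [Module ℂ V] [AddCommGroup E] [Module ℂ E]
  [AddCommGroup F] [Module ℂ F] [AddCommGroup G] [Module ℂ G]

/-- The regular (polynomial) maps from `V` to `E`. -/
def regularMaps (V E : Type*) [AddCommGroup V] [Module ℂ V] [AddCommGroup E] [Module ℂ E] :
    Submodule ℂ (V → E) :=
  Submodule.span ℂ {g | ∃ f ∈ polyFun V, ∃ e : E, g = fun p => f p • e}

/-- `g` is a regular (polynomial) map. -/
def IsReg (g : V → E) : Prop := g ∈ regularMaps V E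

theorem isReg_smul_const {f : V → ℂ} (hf : f ∈ polyFun V) (e : E) : IsReg fun p => f p • e :=
  Submodule.subset_span ⟨f, hf, e, rfl⟩

theorem isReg_zero : IsReg fun _ : V => (0 : E) := (regularMaps V E).zero_mem

theorem IsReg.add {g h : V → E} (hg : IsReg g) (hh : IsReg h) : IsReg fun p => g p + h p :=
  (regularMaps V E).add_mem hg hh

theorem IsReg.const_smul {g : V → E} (hg : IsReg g) (r : ℂ) : IsReg fun p => r • g p :=
  (regularMaps V E).smul_mem r hg

theorem IsReg.sub {g h : V → E} (hg : IsReg g) (hh : IsReg h) : IsReg fun p => g p - h p :=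
  (regularMaps V E).sub_mem hg hh

theorem isReg_sum {ι : Type*} {s : Finset ι} {g : ι → V → E} (h : ∀ i ∈ s, IsReg (g i)) :
    IsReg fun p => ∑ i ∈ s, g i p := by
  have h1 : ∑ i ∈ s, g i = fun p => ∑ i ∈ s, g i p := by
    funext p
    simp
  exact h1 ▸ Submodule.sum_mem (regularMaps V E) h

theorem isReg_const (e : E) : IsReg fun _ : V => e := by
  simpa using isReg_smul_const (one_mem (polyFun V)) e

theorem IsReg.induction {P : (V → E) → Prop}
    (smul_const : ∀ f ∈ polyFun V, ∀ e : E, P fun p => f p • e) (zero : P fun _ => 0)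
    (add : ∀ g h, P g → P h → P fun p => g p + h p)
    (smul : ∀ (r : ℂ) (g), P g → P fun p => r • g p) {g : V → E} (hg : IsReg g) : P g := by
  refine Submodule.span_induction (p := fun g _ => P g) ?_ zero
    (fun g h _ _ hg hh => add g h hg hh) (fun r g _ hg => smul r g hg) hg
  rintro g ⟨f, hf, e, rfl⟩
  exact smul_const f hf e

theorem IsReg.map {g : V → E} (hg : IsReg g) (L : E →ₗ[ℂ] F) : IsReg fun p => L (g p) := by
  refine hg.induction (P := fun g => IsReg fun p => L (g p)) ?_ ?_ ?_ ?_
  · intro f hf e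
    simpa using isReg_smul_const hf (L e)
  · simpa using isReg_zero
  · intro g h hg hh
    simpa using hg.add hh
  · intro r g hg
    simpa using hg.const_smul r

theorem IsReg.smul {g : V → E} (hg : IsReg g) {f : V → ℂ} (hf : f ∈ polyFun V) :
    IsReg fun p => f p • g p := by
  refine hg.induction (P := fun g => IsReg fun p => f p • g p) ?_ ?_ ?_ ?_
  · intro f' hf' e
    simpa [smul_smul] using isReg_smul_const (mul_mem hf hf') e
  · simpa using isReg_zero
  · intro g h hg hh
    simpa using hg.add hh
  · intro r g hg
    simpa [smul_comm r] using hg.const_smul r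

theorem IsReg.mem_polyFun {f : V → ℂ} (hf : IsReg f) : f ∈ polyFun V := by
  refine hf.induction (P := fun g => g ∈ polyFun V) ?_ (zero_mem _)
    (fun g h hg hh => add_mem hg hh) (fun r g hg => (polyFun V).smul_mem hg r)
  intro f hf e
  simpa [mul_comm, Pi.smul_def] using (polyFun V).smul_mem hf e

theorem isReg_of_mem_polyFun {f : V → ℂ} (hf : f ∈ polyFun V) : IsReg f := by
  simpa using isReg_smul_const hf (1 : ℂ)

theorem IsReg.bilin {g : V → E} {h : V → F} (hg : IsReg g) (hh : IsReg h)
    (B : E →ₗ[ℂ] F →ₗ[ℂ] G) : IsReg fun p => B (g p) (h p) := by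
  refine hg.induction (P := fun g => IsReg fun p => B (g p) (h p)) ?_ ?_ ?_ ?_
  · intro f hf e
    simpa using (hh.map (B e)).smul hf
  · simpa using isReg_zero
  · intro g g' hg hg'
    simpa using hg.add hg'
  · intro r g hg
    simpa using hg.const_smul r

theorem isReg_linear [FiniteDimensional ℂ V] (L : V →ₗ[ℂ] E) : IsReg L := by
  let b := Module.finBasis ℂ V
  have h : (L : V → E) = fun p => ∑ i, b.coord i p • L (b i) := by
    funext p
    conv_lhs => rw [← b.sum_repr p, map_sum]
    simp
  rw [h]
  exact isReg_sum fun i _ => isReg_smul_const (Algebra.subset_adjoin ⟨b.coord i, rfl⟩) _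

theorem isReg_pi {ι : Type*} [Fintype ι] {E : ι → Type*} [∀ i, AddCommGroup (E i)]
    [∀ i, Module ℂ (E i)] {g : V → ∀ i, E i} (h : ∀ i, IsReg fun p => g p i) : IsReg g := by
  classical
  have h1 : g = fun p => ∑ i, LinearMap.single ℂ E i (g p i) := by
    funext p j
    simp [Finset.sum_apply]
  rw [h1]
  exact isReg_sum fun i _ => (h i).map _

theorem IsReg.prodMk {g : V → E} {h : V → F} (hg : IsReg g) (hh : IsReg h) :
    IsReg fun p => (g p, h p) := by
  simpa using (hg.map (LinearMap.inl ℂ E F)).add (hh.map (LinearMap.inr ℂ E F))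

/-- Both the polynomial and the point of evaluation vary with `p`. Regular maps into the
infinite-dimensional polynomial ring cause no trouble, being finite sums of `f p • e` with `e`
fixed. -/
theorem IsReg.eval {ℓ : V → Fin 3 → ℂ} (hℓ : IsReg ℓ) {g : V → MvPolynomial (Fin 3) ℂ}
    (hg : IsReg g) : (fun p => eval (ℓ p) (g p)) ∈ polyFun V := by
  refine hg.induction (P := fun g => (fun p => MvPolynomial.eval (ℓ p) (g p)) ∈ polyFun V) ?_ ?_
    (fun g h hg hh => ?_) (fun r g hg => ?_)
  · intro f hf e
    have h1 : (fun p => MvPolynomial.eval (ℓ p) e) ∈ polyFun V := by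
      induction e using MvPolynomial.induction_on with
      | C r => simpa using (isReg_const (V := V) r).mem_polyFun
      | add p q hp hq => simpa [Pi.add_def] using add_mem hp hq
      | mul_X p i hp =>
        simpa [Pi.mul_def] using mul_mem hp (hℓ.map (LinearMap.proj i)).mem_polyFun
    simpa [smul_eval, Pi.mul_def] using mul_mem hf h1
  · simpa using (isReg_zero (V := V) (E := ℂ)).mem_polyFun
  · simpa [Pi.add_def] using add_mem hg hh
  · simpa [smul_eval, Pi.smul_def] using (polyFun V).smul_mem hg r

theorem IsReg.mul {g h : V → MvPolynomial (Fin 3) ℂ} (hg : IsReg g) (hh : IsReg h) :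
    IsReg fun p => g p * h p :=
  hg.bilin hh (LinearMap.mul ℂ _)

end Regular

theorem differentiable_of_mem_polyFun {V : Type*} [NormedAddCommGroup V] [NormedSpace ℂ V]
    [FiniteDimensional ℂ V] {f : V → ℂ} (hf : f ∈ polyFun V) : Differentiable ℂ f := by
  induction hf using Algebra.adjoin_induction with
  | mem f h =>
    obtain ⟨φ, rfl⟩ := h
    exact (LinearMap.toContinuousLinearMap φ).differentiable
  | algebraMap r => exact differentiable_const r
  | add f g _ _ hf hg => exact hf.add hg
  | mul f g _ _ hf hg => exact hf.mul hg

/-! ### Regularity of the coordinates and of the defining equations -/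

variable {d : Fin 2 → ℕ}

theorem isReg_jet (k : Fin 3) : IsReg fun p : Amb d => p.1 k :=
  isReg_linear (V := Amb d) (LinearMap.proj k ∘ₗ LinearMap.fst ℂ Jet _)

theorem polyFun_jet (k i : Fin 3) : (fun p : Amb d => p.1 k i) ∈ polyFun (Amb d) :=
  ((isReg_jet k).map (LinearMap.proj i)).mem_polyFun

theorem isReg_coeff (c : Fin 2) : IsReg fun p : Amb d => p.2.1 c :=
  isReg_linear (V := Amb d) (LinearMap.proj (φ := fun c : Fin 2 => Mon (d c) → ℂ) c ∘ₗ
    LinearMap.fst ℂ _ _ ∘ₗ LinearMap.snd ℂ Jet _)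

theorem polyFun_coeff (c : Fin 2) (γ : Mon (d c)) :
    (fun p : Amb d => p.2.1 c γ) ∈ polyFun (Amb d) :=
  ((isReg_coeff c).map (LinearMap.proj γ)).mem_polyFun

theorem isReg_log (c : Fin 2) : IsReg fun p : Amb d => p.2.2 c :=
  isReg_linear (V := Amb d) (LinearMap.proj (φ := fun _ : Fin 2 => Fin 2 → ℂ) c ∘ₗ
    LinearMap.snd ℂ _ _ ∘ₗ LinearMap.snd ℂ Jet _)

theorem polyFun_log (c k : Fin 2) : (fun p : Amb d => p.2.2 c k) ∈ polyFun (Amb d) :=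
  ((isReg_log c).map (LinearMap.proj k)).mem_polyFun

theorem isReg_form (c : Fin 2) : IsReg fun p : Amb d => form (p.2.1 c) :=
  (isReg_coeff c).map (formLin (d c))

theorem IsReg.jets {F : Amb d → MvPolynomial (Fin 3) ℂ} (hF : IsReg F) (k : Fin 3) :
    (fun p : Amb d => jets (F p) p.1 k) ∈ polyFun (Amb d) := by
  have h1 (j : Fin 3) : IsReg fun p => pderiv j (F p) := hF.map (pderiv j).toLinearMap
  have h2 (j k : Fin 3) : IsReg fun p => pderiv k (pderiv j (F p)) :=
    (h1 j).map (pderiv k).toLinearMap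
  have e1 (j : Fin 3) := (isReg_jet 0).eval (h1 j)
  have e2 (j k : Fin 3) := (isReg_jet 0).eval (h2 j k)
  have s1 (i : Fin 3) : (fun p : Amb d => ∑ j, MvPolynomial.eval (p.1 0) (pderiv j (F p)) * p.1 i j) ∈
      polyFun (Amb d) :=
    (isReg_sum fun j _ => isReg_of_mem_polyFun (mul_mem (e1 j) (polyFun_jet i j))).mem_polyFun
  have s2 : (fun p : Amb d => ∑ j, ∑ k,
      MvPolynomial.eval (p.1 0) (pderiv k (pderiv j (F p))) * p.1 1 j * p.1 1 k) ∈ polyFun (Amb d) :=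
    (isReg_sum fun j _ => isReg_sum fun k _ => isReg_of_mem_polyFun
      (mul_mem (mul_mem (e2 j k) (polyFun_jet 1 j)) (polyFun_jet 1 k))).mem_polyFun
  fin_cases k
  · exact (isReg_jet 0).eval hF
  · exact s1 1
  · exact add_mem (s1 2) s2

theorem eqOne_mem_polyFun (c : Fin 2) : eqOne d c ∈ polyFun (Amb d) :=
  sub_mem ((isReg_form c).jets 1)
    (mul_mem ((isReg_form c).jets 0) (polyFun_log c 0))

theorem eqTwo_mem_polyFun (c : Fin 2) : eqTwo d c ∈ polyFun (Amb d) :=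
  sub_mem ((isReg_form c).jets 2)
    (mul_mem ((isReg_form c).jets 0)
      (add_mem (polyFun_log c 1) (pow_mem (polyFun_log c 0) 2)))

/-! ### Differentials along lines -/

theorem hasDerivAt_line {V E : Type*} [NormedAddCommGroup V] [NormedSpace ℂ V]
    [NormedAddCommGroup E] [NormedSpace ℂ E] {f : V → E} {p : V} (hf : DifferentiableAt ℂ f p)
    (w : V) : HasDerivAt (fun t : ℂ => f (p + t • w)) (fderiv ℂ f p w) 0 := by
  have h1 : HasDerivAt (fun t : ℂ => p + t • w) w 0 := by
    simpa using ((hasDerivAt_id (0 : ℂ)).smul_const w).const_add p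
  have h2 : HasFDerivAt f (fderiv ℂ f p) (p + (0 : ℂ) • w) := by simpa using hf.hasFDerivAt
  exact h2.comp_hasDerivAt (0 : ℂ) h1

/-- The 2-jet of `s_c` in terms of the coordinates. -/
def sectionJet (d : Fin 2 → ℕ) (c : Fin 2) (p : Amb d) : Fin 3 → ℂ := jets (form (p.2.1 c)) p.1

theorem differentiable_sectionJet (c : Fin 2) : Differentiable ℂ (sectionJet d c) :=
  differentiable_pi.2 fun k => differentiable_of_mem_polyFun ((isReg_form c).jets k)

/-- The equation depends on `z` and `a` only through `sectionJet`, so the variation `δ` of that jet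
is all that has to be known about a field in these directions. -/
theorem fderiv_eqOne {c : Fin 2} {p w : Amb d} {δ : Fin 3 → ℂ}
    (h : HasDerivAt (fun t : ℂ => sectionJet d c (p + t • w)) δ 0) :
    fderiv ℂ (eqOne d c) p w = δ 1 - δ 0 * p.2.2 c 0 - sectionJet d c p 0 * w.2.2 c 0 := by
  refine (hasDerivAt_line (differentiable_of_mem_polyFun (eqOne_mem_polyFun c) p) w).unique ?_
  rw [hasDerivAt_pi] at h
  have h1 : HasDerivAt (fun t : ℂ => p.2.2 c 0 + t * w.2.2 c 0) (w.2.2 c 0) 0 := by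
    simpa using ((hasDerivAt_id (0 : ℂ)).mul_const (w.2.2 c 0)).const_add (p.2.2 c 0)
  refine ((h 1).sub ((h 0).mul h1)).congr_deriv ?_
  simp
  ring

theorem fderiv_eqTwo {c : Fin 2} {p w : Amb d} {δ : Fin 3 → ℂ}
    (h : HasDerivAt (fun t : ℂ => sectionJet d c (p + t • w)) δ 0) :
    fderiv ℂ (eqTwo d c) p w = δ 2 - δ 0 * (p.2.2 c 1 + p.2.2 c 0 ^ 2) -
      sectionJet d c p 0 * (w.2.2 c 1 + 2 * p.2.2 c 0 * w.2.2 c 0) := by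
  refine (hasDerivAt_line (differentiable_of_mem_polyFun (eqTwo_mem_polyFun c) p) w).unique ?_
  rw [hasDerivAt_pi] at h
  have h1 (k : Fin 2) : HasDerivAt (fun t : ℂ => p.2.2 c k + t * w.2.2 c k) (w.2.2 c k) 0 := by
    simpa using ((hasDerivAt_id (0 : ℂ)).mul_const (w.2.2 c k)).const_add (p.2.2 c k)
  refine ((h 2).sub ((h 0).mul ((h1 1).add ((h1 0).pow 2)))).congr_deriv ?_
  simp
  ring

/-! ### Behaviour of the equations and of the charts under changes of coordinates -/

theorem sectionJet_act {l : Fin 3 → ℂ} (hl : l 0 ≠ 0) (μ : Fin 2 → ℂ) (c : Fin 2) (p : Amb d) :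
    sectionJet d c (act d l μ p) = μ c • mulJet (powJet l (d c)) (sectionJet d c p) := by
  simp only [sectionJet, act, form_smul, jets_smul, scalesBy_form hl _ _]

theorem eqOne_eq (c : Fin 2) (p : Amb d) :
    eqOne d c p = sectionJet d c p 1 - sectionJet d c p 0 * p.2.2 c 0 := rfl

theorem eqTwo_eq (c : Fin 2) (p : Amb d) :
    eqTwo d c p = sectionJet d c p 2 - sectionJet d c p 0 * (p.2.2 c 1 + p.2.2 c 0 ^ 2) := rfl

theorem eqOne_act {l : Fin 3 → ℂ} (hl : l 0 ≠ 0) (μ : Fin 2 → ℂ) (c : Fin 2) (p : Amb d) :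
    eqOne d c (act d l μ p) = μ c * l 0 ^ d c * eqOne d c p := by
  rw [eqOne_eq, eqOne_eq, sectionJet_act hl]
  simp [act, mulJet, powJet, logJet, Matrix.vecHead, Matrix.vecTail]
  ring

/-- The pair of equations transforms by a triangular matrix with nonzero diagonal, so its common
zero locus is preserved. -/
theorem eqTwo_act {l : Fin 3 → ℂ} (hl : l 0 ≠ 0) (μ : Fin 2 → ℂ) (c : Fin 2) (p : Amb d) :
    eqTwo d c (act d l μ p) =
      μ c * l 0 ^ d c * (eqTwo d c p + 2 * d c * (l 1 / l 0) * eqOne d c p) := by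
  rw [eqOne_eq, eqTwo_eq, eqTwo_eq, sectionJet_act hl]
  simp [act, mulJet, powJet, logJet, Matrix.vecHead, Matrix.vecTail]
  ring

theorem invJet_mulJet {l m : Fin 3 → ℂ} (hl : l 0 ≠ 0) (hm : m 0 ≠ 0) :
    mulJet (invJet (mulJet l m)) l = invJet m := by
  funext k
  fin_cases k <;> simp [invJet, mulJet] <;> field_simp <;> ring

theorem act_mem_domain {χ : Chart d} {l : Fin 3 → ℂ} {μ : Fin 2 → ℂ} {p : Amb d}
    (hl : l 0 ≠ 0) (hμ : ∀ c, μ c ≠ 0) (hp : p ∈ domain d χ) : act d l μ p ∈ domain d χ := by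
  refine ⟨?_, fun c => ?_⟩
  · simpa [act, scaleJet, hl] using hp.1
  · simpa [act, hμ c] using hp.2 c

theorem normalize_act {χ : Chart d} {l : Fin 3 → ℂ} {μ : Fin 2 → ℂ} {p : Amb d}
    (hl : l 0 ≠ 0) (hμ : ∀ c, μ c ≠ 0) (hp : p ∈ domain d χ) :
    normalize d χ (act d l μ p) = normalize d χ p := by
  have h1 : (fun k => (act d l μ p).1 k χ.1) = mulJet l (fun k => p.1 k χ.1) := by
    funext k
    fin_cases k <;> simp [act, scaleJet, mulJet]
  rw [normalize, h1, act_act d _ _ _ _ (invJet_ne _ (mulJet_ne _ _ hl hp.1)) hl,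
    invJet_mulJet hl hp.1, normalize]
  congr 1
  funext c
  have := hμ c
  have := hp.2 c
  simp [act]
  field_simp

theorem slice_subset_domain {χ : Chart d} {p : Amb d} (hp : p ∈ slice d χ) : p ∈ domain d χ := by
  obtain ⟨-, h0, -, -, h⟩ := hp
  exact ⟨by simp [h0], fun c => by simp [h c]⟩

theorem normalize_eq_self {χ : Chart d} {p : Amb d} (hp : p ∈ slice d χ) :
    normalize d χ p = p := by
  obtain ⟨-, h0, h1, h2, h⟩ := hp
  have e1 : invJet (fun k => p.1 k χ.1) = oneJet := by
    funext k
    fin_cases k <;> simp [invJet, oneJet, h0, h1, h2]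
  have e2 : (fun c => (p.2.1 c (χ.2 c))⁻¹) = 1 := by
    funext c
    simp [h c]
  rw [normalize, e1, e2, act_one]

theorem isOpen_domain (χ : Chart d) : IsOpen (domain d χ) := by
  have h1 : domain d χ = {p | p.1 0 χ.1 ≠ 0} ∩ ⋂ c, {p | p.2.1 c (χ.2 c) ≠ 0} := by
    ext p
    simp [domain]
  rw [h1]
  refine IsOpen.inter (isOpen_ne_fun (by fun_prop) (by fun_prop)) (isOpen_iInter_of_finite fun c =>
    isOpen_ne_fun ?_ (by fun_prop))
  exact (differentiable_of_mem_polyFun (polyFun_coeff c (χ.2 c))).continuous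

theorem differentiableAt_jet (k i : Fin 3) (p : Amb d) :
    DifferentiableAt ℂ (fun p : Amb d => p.1 k i) p :=
  differentiable_of_mem_polyFun (polyFun_jet k i) p

theorem differentiableAt_quotient {V : Type*} [NormedAddCommGroup V] [NormedSpace ℂ V] {f g : V → ℂ}
    {p : V} (hf : DifferentiableAt ℂ f p) (hg : DifferentiableAt ℂ g p) (h0 : g p ≠ 0) :
    DifferentiableAt ℂ (fun q => f q / g q) p := by
  simpa only [div_eq_mul_inv] using hf.fun_mul (hg.fun_inv h0)

theorem differentiableAt_invJet (χ : Chart d) {p : Amb d} (hp : p ∈ domain d χ) (k : Fin 3) :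
    DifferentiableAt ℂ (fun p : Amb d => invJet (fun k => p.1 k χ.1) k) p := by
  have h0 : p.1 0 χ.1 ≠ 0 := hp.1
  have h k := differentiableAt_jet k χ.1 p
  fin_cases k
  · exact differentiableAt_quotient (differentiableAt_const 1) (h 0) h0
  · exact differentiableAt_quotient (h 1).fun_neg ((h 0).fun_pow 2) (pow_ne_zero 2 h0)
  · exact (differentiableAt_quotient (((h 1).fun_pow 2).const_mul 2) ((h 0).fun_pow 3)
      (pow_ne_zero 3 h0)).sub
      (differentiableAt_quotient (h 2) ((h 0).fun_pow 2) (pow_ne_zero 2 h0))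

theorem differentiableAt_normalize (χ : Chart d) {p : Amb d} (hp : p ∈ domain d χ) :
    DifferentiableAt ℂ (normalize d χ) p := by
  have h0 : p.1 0 χ.1 ≠ 0 := hp.1
  have hi := differentiableAt_invJet χ hp
  have hj (k : Fin 3) : DifferentiableAt ℂ (fun p : Amb d => p.1 k) p :=
    differentiableAt_pi.2 fun i => differentiableAt_jet k i p
  have ha (c : Fin 2) (γ : Mon (d c)) : DifferentiableAt ℂ (fun p : Amb d => p.2.1 c γ) p :=
    differentiable_of_mem_polyFun (polyFun_coeff c γ) p
  have hη (c k : Fin 2) : DifferentiableAt ℂ (fun p : Amb d => p.2.2 c k) p :=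
    differentiable_of_mem_polyFun (polyFun_log c k) p
  have hi0 : invJet (fun k => p.1 k χ.1) 0 ≠ 0 := invJet_ne _ h0
  refine DifferentiableAt.prodMk ?_ (DifferentiableAt.prodMk ?_ ?_)
  · refine differentiableAt_pi.2 fun k => ?_
    fin_cases k
    · exact (hi 0).smul (hj 0)
    · exact ((hi 0).smul (hj 1)).add ((hi 1).smul (hj 0))
    · exact (((hi 0).smul (hj 2)).add (((hi 1).const_mul 2).smul (hj 1))).add ((hi 2).smul (hj 0))
  · exact differentiableAt_pi.2 fun c => differentiableAt_pi.2 fun γ =>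
      ((ha c (χ.2 c)).inv (hp.2 c)).mul (ha c γ)
  · refine differentiableAt_pi.2 fun c => differentiableAt_pi.2 fun k => ?_
    have q1 := differentiableAt_quotient (hi 1) (hi 0) hi0
    have q2 := differentiableAt_quotient (hi 2) (hi 0) hi0
    fin_cases k
    · exact (hη c 0).add (q1.const_mul _)
    · exact (hη c 1).add ((q2.sub (q1.pow 2)).const_mul _)

/-- The linear part of a change of coordinates. -/
def actLin (d : Fin 2 → ℕ) (l : Fin 3 → ℂ) (μ : Fin 2 → ℂ) (w : Amb d) : Amb d :=
  (scaleJet l w.1, fun c => μ c • w.2.1 c, w.2.2)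

theorem act_add_smul (l : Fin 3 → ℂ) (μ : Fin 2 → ℂ) (p w : Amb d) (t : ℂ) :
    act d l μ (p + t • w) = act d l μ p + t • actLin d l μ w := by
  refine Prod.ext ?_ (Prod.ext ?_ ?_)
  · funext k i
    fin_cases k <;> simp [act, actLin, scaleJet] <;> ring
  · funext c
    simp [act, actLin, smul_comm t]
  · funext c k
    simp [act, actLin]
    ring

/-- The map `act d l μ` is affine with linear part `actLin d l μ`, so this is the derivative of the
invariance `normalize_act` along a line. -/
theorem fderiv_normalize_actLin {χ : Chart d} {l : Fin 3 → ℂ} {μ : Fin 2 → ℂ} {p : Amb d}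
    (hl : l 0 ≠ 0) (hμ : ∀ c, μ c ≠ 0) (hp : p ∈ domain d χ) (w : Amb d) :
    fderiv ℂ (normalize d χ) (act d l μ p) (actLin d l μ w) = fderiv ℂ (normalize d χ) p w := by
  have h1 := hasDerivAt_line (differentiableAt_normalize χ (act_mem_domain hl hμ hp))
    (actLin d l μ w)
  refine h1.unique ((hasDerivAt_line (differentiableAt_normalize χ hp) w).congr_of_eventuallyEq ?_)
  have h2 : Continuous fun t : ℂ => p + t • w := by fun_prop
  have h3 : ∀ᶠ t : ℂ in nhds 0, p + t • w ∈ domain d χ :=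
    h2.continuousAt.eventually_mem ((isOpen_domain χ).mem_nhds (by simpa using hp))
  filter_upwards [h3] with t ht
  rw [← act_add_smul, normalize_act hl hμ ht]

/-- Normalizing in `χ` before `χ'` changes nothing near `p`, and `p` is a fixed point of the first
normalization; this is the chain rule. -/
theorem fderiv_normalize_normalize {χ χ' : Chart d} {p : Amb d} (hp : p ∈ slice d χ)
    (hp' : p ∈ domain d χ') (w : Amb d) :
    fderiv ℂ (normalize d χ') p (fderiv ℂ (normalize d χ) p w) = fderiv ℂ (normalize d χ') p w := by
  have hd := slice_subset_domain hp
  have h1 : normalize d χ' =ᶠ[nhds p] normalize d χ' ∘ normalize d χ := by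
    filter_upwards [(isOpen_domain χ).mem_nhds hd, (isOpen_domain χ').mem_nhds hp'] with q hq hq'
    exact (normalize_act (invJet_ne _ hq.1) (fun c => inv_ne_zero (hq.2 c)) hq').symm
  have h2 := normalize_eq_self hp
  have h3 := differentiableAt_normalize χ' hp'
  rw [← h2] at h3
  conv_rhs => rw [h1.fderiv_eq, fderiv_comp p h3 (differentiableAt_normalize χ hd), h2]
  rfl

/-! ### The differential of the normalization -/

/-- The differential of the normalization at a point of the chart. -/
def project (d : Fin 2 → ℕ) (χ : Chart d) (p w : Amb d) : Amb d :=
  (![w.1 0 - w.1 0 χ.1 • p.1 0, w.1 1 - w.1 0 χ.1 • p.1 1 - w.1 1 χ.1 • p.1 0,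
      w.1 2 - w.1 0 χ.1 • p.1 2 - (2 * w.1 1 χ.1) • p.1 1 - w.1 2 χ.1 • p.1 0],
    fun c => w.2.1 c - w.2.1 c (χ.2 c) • p.2.1 c,
    fun c => w.2.2 c - (d c : ℂ) • ![w.1 1 χ.1, w.1 2 χ.1])

theorem hasDerivAt_add_mul (a b : ℂ) : HasDerivAt (fun t : ℂ => a + t * b) b 0 := by
  simpa using ((hasDerivAt_id (0 : ℂ)).mul_const b).const_add a

theorem hasDerivAt_invJet {u : Fin 3 → ℂ} (v : Fin 3 → ℂ) (hu : u = oneJet) (k : Fin 3) :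
    HasDerivAt (fun t : ℂ => invJet (fun k => u k + t * v k) k) (-v k) 0 := by
  have h k := hasDerivAt_add_mul (u k) (v k)
  have e0 : u 0 + 0 * v 0 ≠ 0 := by simp [hu, oneJet]
  fin_cases k
  · refine ((hasDerivAt_const 0 1).div (h 0) e0).congr_deriv ?_
    simp [hu, oneJet]
  · refine ((h 1).neg.div ((h 0).pow 2) (pow_ne_zero 2 e0)).congr_deriv ?_
    simp [hu, oneJet]
  · refine ((((h 1).pow 2).const_mul 2).div ((h 0).pow 3) (pow_ne_zero 3 e0)|>.sub
      ((h 2).div ((h 0).pow 2) (pow_ne_zero 2 e0))).congr_deriv ?_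
    simp [hu, oneJet]

/-- On the slice the normalizing jet is `1`, so only its first variation, the negative of the jet
`w.1 k χ.1`, enters. -/
theorem fderiv_normalize {χ : Chart d} {p : Amb d} (hp : p ∈ slice d χ) (w : Amb d) :
    fderiv ℂ (normalize d χ) p w = project d χ p w := by
  have hu : (fun k => p.1 k χ.1) = oneJet := by
    obtain ⟨-, h0, h1, h2, -⟩ := hp
    funext k
    fin_cases k <;> simp [oneJet, h0, h1, h2]
  have ha := hp.2.2.2.2
  refine (hasDerivAt_line (differentiableAt_normalize χ (slice_subset_domain hp)) w).unique ?_
  have hi := hasDerivAt_invJet (fun k => w.1 k χ.1) hu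
  have hi0 : invJet (fun k => p.1 k χ.1 + 0 * w.1 k χ.1) = oneJet := by
    have : (fun k => p.1 k χ.1 + 0 * w.1 k χ.1) = oneJet := by simpa using hu
    rw [this]
    funext k
    fin_cases k <;> simp [invJet, oneJet]
  have hi0' : invJet (fun k => p.1 k χ.1 + 0 * w.1 k χ.1) 0 ≠ 0 := by
    rw [hi0]
    simp [oneJet]
  have hi1 : invJet (fun k => p.1 k χ.1) = oneJet := by simpa using hi0
  have hz (k i) := hasDerivAt_add_mul (p.1 k i) (w.1 k i)
  have hη (c k) := hasDerivAt_add_mul (p.2.2 c k) (w.2.2 c k)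
  have hc (c γ) := hasDerivAt_add_mul (p.2.1 c γ) (w.2.1 c γ)
  refine HasDerivAt.prodMk ?_ (HasDerivAt.prodMk ?_ ?_)
  · refine hasDerivAt_pi.2 fun k => hasDerivAt_pi.2 fun i => ?_
    fin_cases k
    · refine ((hi 0).mul (hz 0 i)).congr_deriv ?_
      rw [hi0]
      simp [oneJet]
      ring
    · refine (((hi 0).mul (hz 1 i)).add ((hi 1).mul (hz 0 i))).congr_deriv ?_
      rw [hi0]
      simp [oneJet]
      ring
    · refine ((((hi 0).mul (hz 2 i)).add (((hi 1).const_mul 2).mul (hz 1 i))).add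
        ((hi 2).mul (hz 0 i))).congr_deriv ?_
      rw [hi0]
      simp [oneJet]
      ring
  · refine hasDerivAt_pi.2 fun c => hasDerivAt_pi.2 fun γ => ?_
    have : p.2.1 c (χ.2 c) + 0 * w.2.1 c (χ.2 c) ≠ 0 := by simp [ha c]
    refine (((hc c (χ.2 c)).inv this).mul (hc c γ)).congr_deriv ?_
    simp [ha c]
    ring
  · refine hasDerivAt_pi.2 fun c => hasDerivAt_pi.2 fun k => ?_
    fin_cases k
    · refine ((hη c 0).add (((hi 1).div (hi 0) hi0').const_mul _)).congr_deriv ?_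
      rw [hi0]
      simp [oneJet]
      ring
    · refine ((hη c 1).add ((((hi 2).div (hi 0) hi0').sub
        (((hi 1).div (hi 0) hi0').pow 2)).const_mul _)).congr_deriv ?_
      rw [hi0]
      simp [hi1, oneJet]
      ring

/-- Composed with `normalize`, the equations become combinations of themselves with coefficients
built from `U` and `K`. Where they vanish, differentiating these identities gives combinations of
their differentials, which kill `w`. -/
theorem project_mem_tangentSpace {χ : Chart d} {p : Amb d} (hp : p ∈ slice d χ) {w : Amb d}
    (hw : ∀ c, fderiv ℂ (eqOne d c) p w = 0 ∧ fderiv ℂ (eqTwo d c) p w = 0) :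
    project d χ p w ∈ tangentSpace d χ p := by
  obtain ⟨h0, h1, h2, ha⟩ := hp.2
  refine ⟨fun k => ?_, fun c => ?_, fun c => ?_⟩
  · fin_cases k <;> simp [project, h0, h1, h2]
  · simp [project, ha c]
  · have hD := slice_subset_domain hp
    have hN := differentiableAt_normalize χ hD
    have hself := normalize_eq_self hp
    have d1 := differentiable_of_mem_polyFun (eqOne_mem_polyFun (d := d) c)
    have d2 := differentiable_of_mem_polyFun (eqTwo_mem_polyFun (d := d) c)
    let U : Amb d → ℂ := fun q => (q.2.1 c (χ.2 c))⁻¹ * invJet (fun k => q.1 k χ.1) 0 ^ d c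
    let K : Amb d → ℂ := fun q =>
      2 * d c * (invJet (fun k => q.1 k χ.1) 1 / invJet (fun k => q.1 k χ.1) 0)
    have hU : DifferentiableAt ℂ U p :=
      ((differentiable_of_mem_polyFun (polyFun_coeff c (χ.2 c)) p).inv (hD.2 c)).mul
        ((differentiableAt_invJet χ hD 0).pow _)
    have hi0 : invJet (fun k => p.1 k χ.1) 0 ≠ 0 := invJet_ne _ hD.1
    have hK : DifferentiableAt ℂ K p :=
      (differentiableAt_quotient (differentiableAt_invJet χ hD 1) (differentiableAt_invJet χ hD 0)
        hi0).const_mul _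
    have hK0 : K p = 0 := by simp [K, invJet, h1]
    have ev := (isOpen_domain χ).mem_nhds hD
    have z1 : eqOne d c p = 0 := (hp.1.2.2 c).1
    have z2 : eqTwo d c p = 0 := (hp.1.2.2 c).2
    have e1 : eqOne d c ∘ normalize d χ =ᶠ[nhds p] fun q => U q * eqOne d c q := by
      filter_upwards [ev] with q hq
      exact eqOne_act (invJet_ne _ hq.1) _ c q
    have e2 : eqTwo d c ∘ normalize d χ =ᶠ[nhds p]
        fun q => U q * (eqTwo d c q + K q * eqOne d c q) := by
      filter_upwards [ev] with q hq
      exact eqTwo_act (invJet_ne _ hq.1) _ c q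
    have c1 := fderiv_comp p (d1 (normalize d χ p)) hN
    have c2 := fderiv_comp p (d2 (normalize d χ p)) hN
    rw [e1.fderiv_eq, hself, fderiv_fun_mul hU (d1 p)] at c1
    rw [e2.fderiv_eq, hself, fderiv_fun_mul hU ((d2 p).fun_add (hK.fun_mul (d1 p))),
      fderiv_fun_add (d2 p) (hK.fun_mul (d1 p)), fderiv_fun_mul hK (d1 p)] at c2
    have c1' := congrArg (fun L => L w) c1
    have c2' := congrArg (fun L => L w) c2
    simp only [ContinuousLinearMap.comp_apply, fderiv_normalize hp] at c1' c2'
    rw [← c1', ← c2']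
    simp [z1, z2, hw c, hK0]

/-! ### Equivariant vector fields -/

/-- Polynomial vector fields in homogeneous coordinates, which are tangent to the cone and
equivariant with weight `e`. -/
def equivariantFields (d : Fin 2 → ℕ) (e : ℕ) : Submodule ℂ (Amb d → Amb d) where
  carrier := {W | IsReg W ∧
    (∀ p ∈ cone d, ∀ c, fderiv ℂ (eqOne d c) p (W p) = 0 ∧ fderiv ℂ (eqTwo d c) p (W p) = 0) ∧
    ∀ l μ p, l 0 ≠ 0 → (∀ c, μ c ≠ 0) → W (act d l μ p) = l 0 ^ e • actLin d l μ (W p)}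
  zero_mem' := by
    refine ⟨isReg_zero, fun p _ c => by simp, fun l μ p _ _ => ?_⟩
    have : actLin d l μ 0 = 0 := by
      simpa [act_one] using act_add_smul l μ (0 : Amb d) 0 1
    simp [this]
  add_mem' := by
    rintro V W ⟨hV, hV1, hV2⟩ ⟨hW, hW1, hW2⟩
    refine ⟨hV.add hW, fun p hp c => by simp [hV1 p hp c, hW1 p hp c], fun l μ p hl hμ => ?_⟩
    rw [Pi.add_apply, Pi.add_apply, hV2 l μ p hl hμ, hW2 l μ p hl hμ, ← smul_add]
    congr 1
    refine Prod.ext ?_ (Prod.ext ?_ ?_)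
    · funext k i
      fin_cases k <;> simp [actLin, scaleJet] <;> ring
    · simp [actLin]
      rfl
    · simp [actLin]
  smul_mem' := by
    rintro r V ⟨hV, hV1, hV2⟩
    refine ⟨hV.const_smul r, fun p hp c => by simp [hV1 p hp c], fun l μ p hl hμ => ?_⟩
    rw [Pi.smul_apply, Pi.smul_apply, hV2 l μ p hl hμ, smul_comm]
    congr 1
    refine Prod.ext ?_ (Prod.ext ?_ ?_)
    · funext k i
      fin_cases k <;> simp [actLin, scaleJet] <;> ring
    · funext c
      simp [actLin, smul_comm r]
    · simp [actLin]

theorem isReg_fst {W : Amb d → Amb d} (hW : IsReg W) (k : Fin 3) : IsReg fun p => (W p).1 k :=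
  hW.map (LinearMap.proj (φ := fun _ : Fin 3 => Fin 3 → ℂ) k ∘ₗ LinearMap.fst ℂ Jet _)

theorem isReg_project {W : Amb d → Amb d} (hW : IsReg W) (χ : Chart d) :
    IsReg fun p => project d χ p (W p) := by
  have w k : IsReg fun p => (W p).1 k := isReg_fst hW k
  have w' k i : (fun p => (W p).1 k i) ∈ polyFun (Amb d) := ((w k).map (LinearMap.proj i)).mem_polyFun
  have wa c : IsReg fun p => (W p).2.1 c :=
    hW.map (LinearMap.proj (φ := fun c : Fin 2 => Mon (d c) → ℂ) c ∘ₗ LinearMap.fst ℂ _ _ ∘ₗ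
      LinearMap.snd ℂ Jet _)
  have wη c : IsReg fun p => (W p).2.2 c :=
    hW.map (LinearMap.proj (φ := fun _ : Fin 2 => Fin 2 → ℂ) c ∘ₗ LinearMap.snd ℂ _ _ ∘ₗ
      LinearMap.snd ℂ Jet _)
  have z k : IsReg fun p : Amb d => p.1 k := isReg_jet k
  refine IsReg.prodMk (isReg_pi fun k => ?_) (IsReg.prodMk (isReg_pi fun c => ?_) (isReg_pi fun c => ?_))
  · fin_cases k
    · exact (w 0).sub ((z 0).smul (w' 0 χ.1))
    · exact ((w 1).sub ((z 1).smul (w' 0 χ.1))).sub ((z 0).smul (w' 1 χ.1))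
    · refine (((w 2).sub ((z 2).smul (w' 0 χ.1))).sub ((z 1).smul ?_)).sub ((z 0).smul (w' 2 χ.1))
      exact (polyFun (Amb d)).smul_mem (w' 1 χ.1) 2
  · exact (wa c).sub ((isReg_coeff c).smul ((wa c).map (LinearMap.proj (χ.2 c))).mem_polyFun)
  · refine (wη c).sub (IsReg.const_smul (isReg_pi fun k => ?_) _)
    fin_cases k
    · exact isReg_of_mem_polyFun (w' 1 χ.1)
    · exact isReg_of_mem_polyFun (w' 2 χ.1)

/-- The section defined by an equivariant vector field. -/
def toTwistedVectorField {e : ℕ} {W : Amb d → Amb d} (hW : W ∈ equivariantFields d e) :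
    TwistedVectorField d e 0 where
  toFun χ p := project d χ p (W p)
  regular χ φ := ⟨fun p => φ (project d χ p (W p)), ((isReg_project hW.1 χ).map φ).mem_polyFun,
    fun _ _ => rfl⟩
  tangent χ p hp := project_mem_tangentSpace hp (hW.2.1 p hp.1)
  compat χ χ' p hp hp' := by
    have hi : invJet (fun k => p.1 k χ'.1) 0 ≠ 0 := invJet_ne _ hp'.1
    have hμ c : (p.2.1 c (χ'.2 c))⁻¹ ≠ 0 := inv_ne_zero (hp'.2 c)
    have hmem : normalize d χ' p ∈ slice d χ' := by
      have hD : normalize d χ' p ∈ domain d χ' := act_mem_domain hi hμ hp'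
      have h0 := hp'.1
      refine ⟨⟨?_, fun c => ?_, fun c => ⟨?_, ?_⟩⟩, ?_, ?_, ?_, fun c => ?_⟩
      · exact fun h => hD.1 (by simp [h])
      · exact fun h => hD.2 c (by simp [h])
      · rw [normalize, eqOne_act hi, (hp.1.2.2 c).1, mul_zero]
      · rw [normalize, eqTwo_act hi, (hp.1.2.2 c).1, (hp.1.2.2 c).2, mul_zero, add_zero, mul_zero]
      · simp [normalize, act, scaleJet, invJet, h0]
      · simp [normalize, act, scaleJet, invJet]
        field_simp
        ring
      · simp [normalize, act, scaleJet, invJet]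
        field_simp
        ring
      · simp [normalize, act, hp'.2 c]
    -- Both sides become the differential of `normalize d χ'` at the normalized point, applied to
    -- multiples of the same vector; the weight `e` of `W` cancels the transition factor.
    rw [← fderiv_normalize hp, fderiv_normalize_normalize hp hp', ← fderiv_normalize hmem,
      ← fderiv_normalize_actLin hi hμ hp' (W p), normalize, hW.2.2 _ _ p hi hμ, map_smul, smul_smul]
    have h0 := hp'.1
    have : p.1 0 χ'.1 ^ e * (invJet (fun k => p.1 k χ'.1) 0) ^ e = 1 := by
      rw [← mul_pow]
      simp [invJet, h0]
    simp [this]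

/-! ### The vector fields -/

theorem isHomogeneous_of_eq {F : MvPolynomial (Fin 3) ℂ} {n m : ℕ} (hF : F.IsHomogeneous n)
    (h : n = m) : F.IsHomogeneous m := h ▸ hF

/-- Raises the weight; in a chart where `Z_k = 1` the value of the field does not change. -/
theorem equivariantFields.mul_pow {e : ℕ} {W : Amb d → Amb d} (hW : W ∈ equivariantFields d e)
    (k : Fin 3) (n : ℕ) : (fun p : Amb d => p.1 0 k ^ n • W p) ∈ equivariantFields d (e + n) := by
  refine ⟨hW.1.smul (pow_mem (polyFun_jet 0 k) n), fun p hp c => by simp [hW.2.1 p hp c],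
    fun l μ p hl hμ => ?_⟩
  have h1 : (act d l μ p).1 0 k = l 0 * p.1 0 k := by simp [act, scaleJet]
  have h2 (r : ℂ) (w : Amb d) : actLin d l μ (r • w) = r • actLin d l μ w := by
    refine Prod.ext ?_ (Prod.ext ?_ ?_)
    · funext k i
      fin_cases k <;> simp [actLin, scaleJet] <;> ring
    · funext c
      simp [actLin, smul_comm r]
    · simp [actLin]
  change (act d l μ p).1 0 k ^ n • W (act d l μ p) = l 0 ^ (e + n) • actLin d l μ (p.1 0 k ^ n • W p)
  rw [h1, hW.2.2 l μ p hl hμ, h2, smul_smul, smul_smul]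
  congr 1
  ring

/-- The derivation of the polynomial ring defined by a linear vector field. -/
def linearField (M : Matrix (Fin 3) (Fin 3) ℂ) : MvPolynomial (Fin 3) ℂ →ₗ[ℂ] MvPolynomial (Fin 3) ℂ :=
  ∑ i, LinearMap.mulLeft ℂ (∑ j, C (M i j) * X j) ∘ₗ (pderiv i).toLinearMap

theorem linearField_apply (M : Matrix (Fin 3) (Fin 3) ℂ) (F : MvPolynomial (Fin 3) ℂ) :
    linearField M F = ∑ i, (∑ j, C (M i j) * X j) * pderiv i F := by
  simp [linearField]

theorem linearField_mul_X (M : Matrix (Fin 3) (Fin 3) ℂ) (F : MvPolynomial (Fin 3) ℂ) (i : Fin 3) :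
    linearField M (F * X i) = linearField M F * X i + F * ∑ j, C (M i j) * X j := by
  simp only [linearField_apply, Derivation.leibniz, pderiv_X, smul_eq_mul, mul_add,
    Finset.sum_add_distrib]
  rw [Finset.sum_eq_single i (fun k _ hk => by simp [hk.symm]) (by simp), add_comm]
  refine congrArg₂ (· + ·) ?_ ?_
  · rw [Finset.sum_mul Finset.univ (fun i => (∑ j, C (M i j) * X j) * pderiv i F)]
    refine Finset.sum_congr rfl fun k _ => ?_
    ring
  · rw [Pi.single_eq_same, mul_one, mul_comm]

theorem linearField_isHomogeneous (M : Matrix (Fin 3) (Fin 3) ℂ) {F : MvPolynomial (Fin 3) ℂ} {n : ℕ}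
    (hF : F.IsHomogeneous (n + 1)) : (linearField M F).IsHomogeneous (n + 1) := by
  rw [linearField_apply]
  refine IsHomogeneous.sum _ _ _ fun i _ => ?_
  rw [add_comm]
  refine IsHomogeneous.mul (IsHomogeneous.sum _ _ _ fun j _ => isHomogeneous_C_mul_X _ _) ?_
  simpa using hF.pderiv (i := i)

/-- The moved jet is that of `(1 + tM) Z`, and the derivative of `F ∘ (1 + tM)` at `t = 0` is
`linearField M F`. -/
theorem hasDerivAt_jets_linear (M : Matrix (Fin 3) (Fin 3) ℂ) (z : Jet) (F : MvPolynomial (Fin 3) ℂ) :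
    HasDerivAt (fun t : ℂ => jets F (z + t • fun k => M.mulVec (z k))) (jets (linearField M F) z) 0 := by
  induction F using MvPolynomial.induction_on with
  | C r =>
    have : linearField M (C r) = 0 := by simp [linearField_apply]
    simp only [jets_C, this, jets_zero]
    exact hasDerivAt_const _ _
  | add F G hF hG =>
    simp only [jets_add, map_add]
    exact hF.add hG
  | mul_X F i hF =>
    have hX (k : Fin 3) := hasDerivAt_add_mul (z k i) (M.mulVec (z k) i)
    have hs : jets (∑ j, C (M i j) * X j) z = fun k => M.mulVec (z k) i := by
      funext k
      simp only [jets_sum, Finset.sum_apply, ← smul_eq_C_mul, jets_smul, jets_X]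
      rfl
    rw [hasDerivAt_pi] at hF ⊢
    simp only [jets_mul, jets_X, linearField_mul_X, jets_add, hs]
    intro k
    fin_cases k
    · refine ((hF 0).mul (hX 0)).congr_deriv ?_
      simp [mulJet]
    · refine (((hF 0).mul (hX 1)).add ((hF 1).mul (hX 0))).congr_deriv ?_
      simp [mulJet]
      ring
    · refine ((((hF 0).mul (hX 2)).add (((hF 1).const_mul 2).mul (hX 1))).add
        ((hF 2).mul (hX 0))).congr_deriv ?_
      simp [mulJet]
      ring

/-- The vector field induced by a linear vector field on `ℂ³`. -/
def linearLift (d : Fin 2 → ℕ) (M : Matrix (Fin 3) (Fin 3) ℂ) (p : Amb d) : Amb d :=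
  (fun k => M.mulVec (p.1 k), fun c => - coefs (d c) (linearField M (form (p.2.1 c))), 0)

/-- Infinitesimally, `F(Z)` is unchanged when `Z` moves by `M` and `F` by `-linearField M F`. Hence
`δ = 0`, and the zero variation of `η` is tangent. -/
theorem linearLift_mem (hd : ∀ c, 1 ≤ d c) (M : Matrix (Fin 3) (Fin 3) ℂ) :
    linearLift d M ∈ equivariantFields d 0 := by
  refine ⟨?_, fun p hp c => ?_, fun l μ p hl hμ => ?_⟩
  · refine IsReg.prodMk (isReg_pi fun k => (isReg_jet k).map M.mulVecLin)
      (IsReg.prodMk (isReg_pi fun c => ?_) isReg_zero)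
    exact (isReg_form c).map (-(coefs (d c) ∘ₗ linearField M))
  · have hhom : (linearField M (form (p.2.1 c))).IsHomogeneous (d c) := by
      obtain ⟨n, hn⟩ := Nat.exists_eq_add_of_le' (hd c)
      have := form_isHomogeneous (p.2.1 c)
      exact isHomogeneous_of_eq (linearField_isHomogeneous M (isHomogeneous_of_eq this hn)) hn.symm
    have h1 : form ((linearLift d M p).2.1 c) = - linearField M (form (p.2.1 c)) := by
      have := form_smul (-1) (coefs (d c) (linearField M (form (p.2.1 c))))
      rw [form_coefs hhom] at this
      simpa [linearLift] using this
    have h2 : HasDerivAt (fun t : ℂ => sectionJet d c (p + t • linearLift d M p)) 0 0 := by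
      have a1 := hasDerivAt_jets_linear M p.1 (form (p.2.1 c))
      have a2 := hasDerivAt_jets_linear M p.1 (- linearField M (form (p.2.1 c)))
      have a3 := a1.add ((hasDerivAt_id (0 : ℂ)).smul a2)
      refine (a3.congr_deriv ?_).congr_of_eventuallyEq (Filter.Eventually.of_forall fun t => ?_)
      · simp [jets_neg]
      · simp only [sectionJet, Prod.snd_add, Prod.fst_add, Prod.smul_snd, Prod.smul_fst, Pi.add_apply,
          Pi.smul_apply, form_add, form_smul, h1, jets_add, jets_smul, Pi.smul_apply', id]
        rfl
    rw [fderiv_eqOne h2, fderiv_eqTwo h2]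
    simp [linearLift]
  · rw [pow_zero, one_smul]
    refine Prod.ext ?_ (Prod.ext ?_ ?_)
    · funext k
      fin_cases k <;> simp [linearLift, act, actLin, scaleJet, Matrix.mulVec_add, Matrix.mulVec_smul]
    · funext c
      simp [linearLift, act, actLin, form_smul]
    · rfl

/-- A tangent vector which moves the component `c` and its logarithmic coordinates only. -/
def vertical (d : Fin 2 → ℕ) (c : Fin 2) (b : Mon (d c) → ℂ) (θ : Fin 2 → ℂ) : Amb d :=
  (0, Pi.single c b, Pi.single c θ)

theorem hasDerivAt_sectionJet_vertical (c : Fin 2) (b : Mon (d c) → ℂ) (θ : Fin 2 → ℂ) (p : Amb d) :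
    HasDerivAt (fun t : ℂ => sectionJet d c (p + t • vertical d c b θ)) (jets (form b) p.1) 0 := by
  have : HasDerivAt (fun t : ℂ => sectionJet d c p + t • jets (form b) p.1) (jets (form b) p.1) 0 := by
    simpa using ((hasDerivAt_id (0 : ℂ)).smul_const (jets (form b) p.1)).const_add (sectionJet d c p)
  refine this.congr_of_eventuallyEq (Filter.Eventually.of_forall fun t => ?_)
  simp [sectionJet, vertical, form_add, form_smul, jets_add, jets_smul]

/-- The section is linear in its coefficients, so `δ` is the jet of `B` and tangency becomes `h1`,
`h2`. The other component does not move. -/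
theorem vertical_mem {e : ℕ} {c : Fin 2} {B : Amb d → MvPolynomial (Fin 3) ℂ} {θ : Amb d → Fin 2 → ℂ}
    (hB : IsReg B) (hθ : IsReg θ) (hhom : ∀ p, (B p).IsHomogeneous (d c))
    (h1 : ∀ p ∈ cone d, jets (B p) p.1 1 - jets (B p) p.1 0 * p.2.2 c 0 -
      sectionJet d c p 0 * θ p 0 = 0)
    (h2 : ∀ p ∈ cone d, jets (B p) p.1 2 - jets (B p) p.1 0 * (p.2.2 c 1 + p.2.2 c 0 ^ 2) -
      sectionJet d c p 0 * (θ p 1 + 2 * p.2.2 c 0 * θ p 0) = 0)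
    (hBe : ∀ l μ p, l 0 ≠ 0 → B (act d l μ p) = (l 0 ^ e * μ c) • B p)
    (hθe : ∀ l μ p, l 0 ≠ 0 → θ (act d l μ p) = l 0 ^ e • θ p) :
    (fun p => vertical d c (coefs (d c) (B p)) (θ p)) ∈ equivariantFields d e := by
  refine ⟨?_, fun p hp c' => ?_, fun l μ p hl hμ => ?_⟩
  · exact isReg_zero.prodMk ((hB.map (LinearMap.single ℂ (fun c => Mon (d c) → ℂ) c ∘ₗ coefs (d c))).prodMk
      (hθ.map (LinearMap.single ℂ (fun _ => Fin 2 → ℂ) c)))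
  · by_cases hc : c' = c
    · subst hc
      have a1 := hasDerivAt_sectionJet_vertical c' (coefs (d c') (B p)) (θ p) p
      rw [form_coefs (hhom p)] at a1
      rw [fderiv_eqOne a1, fderiv_eqTwo a1]
      simpa [vertical] using ⟨h1 p hp, h2 p hp⟩
    · have a1 : HasDerivAt (fun t : ℂ =>
          sectionJet d c' (p + t • vertical d c (coefs (d c) (B p)) (θ p))) 0 0 := by
        refine (hasDerivAt_const 0 (sectionJet d c' p)).congr_of_eventuallyEq
          (Filter.Eventually.of_forall fun t => ?_)
        simp [sectionJet, vertical, hc]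
      rw [fderiv_eqOne a1, fderiv_eqTwo a1]
      simp [vertical, hc]
  · refine Prod.ext ?_ (Prod.ext ?_ ?_)
    · funext k
      fin_cases k <;> simp [vertical, actLin, scaleJet]
    · funext c'
      by_cases hc : c' = c
      · subst hc
        simp [vertical, actLin, hBe l μ p hl, smul_smul]
      · simp [vertical, actLin, hc]
    · simp [vertical, actLin, hθe l μ p hl, Pi.single_smul]

/-! ### Polars, minor forms and their jets -/

/-- `∑ u_i ∂_i F`. -/
def polar (u : Fin 3 → ℂ) (F : MvPolynomial (Fin 3) ℂ) : MvPolynomial (Fin 3) ℂ :=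
  ∑ i, u i • pderiv i F

theorem polar_smul_smul (r s : ℂ) (u : Fin 3 → ℂ) (F : MvPolynomial (Fin 3) ℂ) :
    polar (r • u) (s • F) = (r * s) • polar u F := by
  simp only [polar, Finset.smul_sum]
  refine Finset.sum_congr rfl fun i _ => ?_
  simp [smul_smul]
  congr 1
  ring

theorem polar_isHomogeneous (u : Fin 3 → ℂ) {F : MvPolynomial (Fin 3) ℂ} {n : ℕ}
    (hF : F.IsHomogeneous (n + 1)) : (polar u F).IsHomogeneous n := by
  refine IsHomogeneous.sum _ _ _ fun i _ => ?_
  have := (hF.pderiv (i := i)).C_mul (u i)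
  simpa [smul_eq_C_mul] using this

theorem eval_polar {u : Fin 3 → ℂ} {F : MvPolynomial (Fin 3) ℂ} {n : ℕ} (hF : F.IsHomogeneous n) :
    eval u (polar u F) = n * eval u F := by
  have := congrArg (eval u) hF.sum_X_mul_pderiv
  simpa [polar, smul_eval] using this

theorem jets_polar_zero (z : Jet) {F : MvPolynomial (Fin 3) ℂ} {n : ℕ} (hF : F.IsHomogeneous n) :
    jets (polar (z 0) F) z 0 = n * jets F z 0 :=
  eval_polar hF

/-- The polar direction is frozen at `z 0`, so the factor is the degree `n` of the partial
derivatives of `F`, not `n + 1`: differentiate Euler's relation once. -/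
theorem jets_polar_one (z : Jet) {F : MvPolynomial (Fin 3) ℂ} {n : ℕ}
    (hF : F.IsHomogeneous (n + 1)) : jets (polar (z 0) F) z 1 = n * jets F z 1 := by
  have h (j : Fin 3) : eval (z 0) (pderiv j (polar (z 0) F)) = n * eval (z 0) (pderiv j F) := by
    have := congrArg (fun G => eval (z 0) (pderiv j G)) hF.sum_X_mul_pderiv
    simp only [map_sum, Derivation.leibniz, pderiv_X, map_add, smul_eq_mul, map_mul, eval_X,
      map_nsmul, Finset.sum_add_distrib, polar, smul_eval, Derivation.map_smul] at this ⊢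
    rw [Finset.sum_eq_single (f := fun i => eval (z 0) (pderiv i F) * _) j
      (fun k _ hk => by simp [hk]) (by simp)] at this
    simp at this
    linear_combination this
  change jetDer _ _ = _ * jetDer _ _
  simp only [jetDer, h, Finset.mul_sum, mul_assoc]

/-- The linear form `u_k X_j - u_j X_k`. -/
def minorForm (u : Fin 3 → ℂ) (k j : Fin 3) : MvPolynomial (Fin 3) ℂ := u k • X j - u j • X k

theorem minorForm_smul (r : ℂ) (u : Fin 3 → ℂ) (k j : Fin 3) :
    minorForm (r • u) k j = r • minorForm u k j := by
  simp [minorForm, smul_sub, smul_smul]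

theorem minorForm_isHomogeneous (u : Fin 3 → ℂ) (k j : Fin 3) : (minorForm u k j).IsHomogeneous 1 := by
  simpa only [minorForm, smul_eq_C_mul] using
    (isHomogeneous_C_mul_X (u k) j).sub (isHomogeneous_C_mul_X (u j) k)

/-- The minor of `z 0` and `z n` in the columns `k` and `j`. -/
def minor (z : Jet) (k j n : Fin 3) : ℂ := z 0 k * z n j - z 0 j * z n k

theorem jets_minorForm (z : Jet) (k j : Fin 3) :
    jets (minorForm (z 0) k j) z = ![0, minor z k j 1, minor z k j 2] := by
  rw [minorForm, sub_eq_add_neg, jets_add, jets_neg, jets_smul, jets_smul, jets_X, jets_X]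
  funext n
  fin_cases n <;> simp [minor] <;> ring

theorem polyFun_minor (k j n : Fin 3) : (fun p : Amb d => minor p.1 k j n) ∈ polyFun (Amb d) :=
  sub_mem (mul_mem (polyFun_jet 0 k) (polyFun_jet n j)) (mul_mem (polyFun_jet 0 j) (polyFun_jet n k))

theorem isReg_minorForm (k j : Fin 3) : IsReg fun p : Amb d => minorForm (p.1 0) k j :=
  ((isReg_const (X j)).smul (polyFun_jet 0 k)).sub ((isReg_const (X k)).smul (polyFun_jet 0 j))

theorem IsReg.polar {F : Amb d → MvPolynomial (Fin 3) ℂ} (hF : IsReg F) :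
    IsReg fun p : Amb d => polar (p.1 0) (F p) :=
  isReg_sum fun i _ => (hF.map (pderiv i).toLinearMap).smul (polyFun_jet 0 i)

theorem minor_scaleJet_one (l : Fin 3 → ℂ) (z : Jet) (k j : Fin 3) :
    minor (scaleJet l z) k j 1 = l 0 ^ 2 * minor z k j 1 := by
  simp [minor, scaleJet]
  ring

theorem minor_scaleJet_two (l : Fin 3 → ℂ) (z : Jet) (k j : Fin 3) :
    minor (scaleJet l z) k j 2 = l 0 ^ 2 * minor z k j 2 + 2 * l 0 * l 1 * minor z k j 1 := by
  simp [minor, scaleJet]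
  ring

/-! ### The four families of vertical fields -/

theorem jets_form_one {p : Amb d} (hp : p ∈ cone d) (c : Fin 2) :
    jets (form (p.2.1 c)) p.1 1 = sectionJet d c p 0 * p.2.2 c 0 :=
  sub_eq_zero.1 (hp.2.2 c).1

theorem jets_form_two {p : Amb d} (hp : p ∈ cone d) (c : Fin 2) :
    jets (form (p.2.1 c)) p.1 2 = sectionJet d c p 0 * (p.2.2 c 1 + p.2.2 c 0 ^ 2) :=
  sub_eq_zero.1 (hp.2.2 c).2

/-- Multiplying `s_c` by a constant leaves its logarithmic derivatives unchanged. -/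
theorem euler_mem (c : Fin 2) :
    (fun p : Amb d => vertical d c (coefs (d c) (form (p.2.1 c))) 0) ∈ equivariantFields d 0 := by
  refine vertical_mem (isReg_form c) isReg_zero (fun p => form_isHomogeneous _) (fun p hp => ?_)
    (fun p hp => ?_) (fun l μ p _ => ?_) (fun l μ p _ => by simp)
  · rw [jets_form_one hp]
    simp [sectionJet]
  · rw [jets_form_two hp]
    simp [sectionJet]
  · simp [act, form_smul]

/-- The minor form vanishes at `Z(0)`, so only the value `d s` and the derivative `(d - 1) s'` of
the polar matter. As `s' = s η₀` on the cone, the product has a jet divisible by `s`, and solving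
for the variation of `η` gives the stated polynomials. Under rescaling, the `l'` terms of the second
minor and of `η₀` cancel. -/
theorem polar_field_mem {c : Fin 2} {n : ℕ} (hn : d c = n + 1) (k j : Fin 3) :
    (fun p : Amb d => vertical d c
      (coefs (d c) (polar (p.1 0) (form (p.2.1 c)) * minorForm (p.1 0) k j))
      ![d c * minor p.1 k j 1, d c * minor p.1 k j 2 - 2 * p.2.2 c 0 * minor p.1 k j 1]) ∈
      equivariantFields d 2 := by
  have hf (p : Amb d) : (form (p.2.1 c)).IsHomogeneous (n + 1) :=
    isHomogeneous_of_eq (form_isHomogeneous _) hn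
  have hj (p : Amb d) (hp : p ∈ cone d) :
      jets (polar (p.1 0) (form (p.2.1 c)) * minorForm (p.1 0) k j) p.1 =
        ![0, d c * sectionJet d c p 0 * minor p.1 k j 1, d c * sectionJet d c p 0 * minor p.1 k j 2 +
          2 * n * sectionJet d c p 0 * p.2.2 c 0 * minor p.1 k j 1] := by
    rw [jets_mul, jets_minorForm]
    funext i
    fin_cases i <;>
      simp [mulJet, jets_polar_zero _ (hf p), jets_polar_one _ (hf p), jets_form_one hp, hn,
        sectionJet, -mul_eq_mul_left_iff, -mul_eq_mul_right_iff]
    ring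
  refine vertical_mem ((isReg_form c).polar.mul (isReg_minorForm k j)) (isReg_pi fun i => ?_)
    (fun p => ?_) (fun p hp => ?_) (fun p hp => ?_) (fun l μ p hl => ?_) (fun l μ p hl => ?_)
  · have m1 := polyFun_minor (d := d) k j 1
    have m2 := polyFun_minor (d := d) k j 2
    fin_cases i
    · exact isReg_of_mem_polyFun ((polyFun (Amb d)).smul_mem m1 (d c : ℂ))
    · exact isReg_of_mem_polyFun (sub_mem ((polyFun (Amb d)).smul_mem m2 (d c : ℂ))
        (mul_mem ((polyFun (Amb d)).smul_mem (polyFun_log c 0) 2) m1))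
  · have := (polar_isHomogeneous (p.1 0) (hf p)).mul (minorForm_isHomogeneous (p.1 0) k j)
    exact isHomogeneous_of_eq this hn.symm
  · rw [hj p hp]
    simp
    ring
  · rw [hj p hp]
    simp [hn]
    ring
  · have : (act d l μ p).1 0 = l 0 • p.1 0 := by simp [act, scaleJet]
    rw [this, minorForm_smul]
    simp only [act, form_smul]
    rw [polar_smul_smul, smul_mul_smul_comm]
    congr 1
    ring
  · funext i
    fin_cases i
    · simp [act, minor_scaleJet_one]
      ring
    · simp [act, minor_scaleJet_one, minor_scaleJet_two, logJet, Matrix.vecHead]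
      field_simp
      ring

/-- The two minor forms give a double zero, so only the value of the second polar survives, which is
`(n + 1)(n + 2) s` by Euler; the remaining `2` is the binomial coefficient in Leibniz's rule. -/
theorem polar_polar_field_mem {c : Fin 2} {n : ℕ} (hn : d c = n + 2) (k i j : Fin 3) :
    (fun p : Amb d => vertical d c
      (coefs (d c) (polar (p.1 0) (polar (p.1 0) (form (p.2.1 c))) *
        (minorForm (p.1 0) k i * minorForm (p.1 0) k j)))
      ![0, 2 * (n + 1) * (n + 2) * (minor p.1 k i 1 * minor p.1 k j 1)]) ∈ equivariantFields d 4 := by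
  have hf (p : Amb d) : (form (p.2.1 c)).IsHomogeneous (n + 1 + 1) :=
    isHomogeneous_of_eq (form_isHomogeneous _) hn
  have hj (p : Amb d) :
      jets (polar (p.1 0) (polar (p.1 0) (form (p.2.1 c))) *
        (minorForm (p.1 0) k i * minorForm (p.1 0) k j)) p.1 =
        ![0, 0, 2 * (n + 1) * (n + 2) * sectionJet d c p 0 * (minor p.1 k i 1 * minor p.1 k j 1)] := by
    rw [jets_mul, jets_mul, jets_minorForm, jets_minorForm]
    funext i
    fin_cases i <;>
      simp [mulJet, jets_polar_zero _ (polar_isHomogeneous _ (hf p)), jets_polar_zero _ (hf p),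
        sectionJet]
    ring
  refine vertical_mem ((isReg_form c).polar.polar.mul ((isReg_minorForm k i).mul (isReg_minorForm k j)))
    (isReg_pi fun a => ?_)
    (fun p => ?_) (fun p hp => ?_) (fun p hp => ?_) (fun l μ p hl => ?_) (fun l μ p hl => ?_)
  · fin_cases a
    · exact isReg_zero
    · exact isReg_of_mem_polyFun ((polyFun (Amb d)).smul_mem
        (mul_mem (polyFun_minor k i 1) (polyFun_minor k j 1)) (2 * (n + 1) * (n + 2) : ℂ))
  · have := (polar_isHomogeneous (p.1 0) (polar_isHomogeneous (p.1 0) (hf p))).mul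
      ((minorForm_isHomogeneous (p.1 0) k i).mul (minorForm_isHomogeneous (p.1 0) k j))
    exact isHomogeneous_of_eq this hn.symm
  · rw [hj p]
    simp
  · rw [hj p]
    simp
    ring
  · have : (act d l μ p).1 0 = l 0 • p.1 0 := by simp [act, scaleJet]
    rw [this, minorForm_smul, minorForm_smul]
    simp only [act, form_smul]
    rw [polar_smul_smul, polar_smul_smul, smul_mul_smul_comm, smul_mul_smul_comm]
    congr 1
    ring
  · funext a
    fin_cases a
    · simp
    · simp [act, minor_scaleJet_one]
      ring

/-- A triple zero has no 2-jet, so nothing has to be divided by `s` and `G` is free. The factor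
`p.2.1 c γ` supplies the weight in `μ c` that a fixed `G` lacks. -/
theorem cubic_field_mem {c : Fin 2} {n : ℕ} (hn : d c = n + 3) (k i j m : Fin 3) (γ : Mon (d c))
    {G : MvPolynomial (Fin 3) ℂ} (hG : G.IsHomogeneous n) :
    (fun p : Amb d => vertical d c (coefs (d c) (p.2.1 c γ • (G *
      (minorForm (p.1 0) k i * minorForm (p.1 0) k j * minorForm (p.1 0) k m)))) 0) ∈
      equivariantFields d 3 := by
  have hj (p : Amb d) : jets (p.2.1 c γ • (G *
      (minorForm (p.1 0) k i * minorForm (p.1 0) k j * minorForm (p.1 0) k m))) p.1 = 0 := by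
    rw [jets_smul, jets_mul, jets_mul, jets_mul, jets_minorForm, jets_minorForm, jets_minorForm]
    funext i
    fin_cases i <;> simp [mulJet]
  refine vertical_mem (((isReg_const G).mul (((isReg_minorForm k i).mul (isReg_minorForm k j)).mul
    (isReg_minorForm k m))).smul (polyFun_coeff c γ)) isReg_zero
    (fun p => ?_) (fun p hp => by simp [hj]) (fun p hp => by simp [hj]) (fun l μ p hl => ?_)
    (fun l μ p hl => by simp)
  · rw [hn, smul_eq_C_mul]
    exact (hG.mul (((minorForm_isHomogeneous _ _ _).mul (minorForm_isHomogeneous _ _ _)).mul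
      (minorForm_isHomogeneous _ _ _))).C_mul _
  · have : (act d l μ p).1 0 = l 0 • p.1 0 := by simp [act, scaleJet]
    rw [this, minorForm_smul, minorForm_smul, minorForm_smul]
    simp only [act, smul_mul_assoc, mul_smul_comm, smul_smul, Pi.smul_apply, smul_eq_mul]
    congr 1
    ring

/-! ### Forms and their order of vanishing at a point -/

/-- The forms vanishing at `u` are generated by the minor forms. The clause for `n = 0` is needed
because the homogeneity clause is void there. -/
theorem exists_eq_add_sum_minorForm {u : Fin 3 → ℂ} {k : Fin 3} (hu : u k = 1) (n : ℕ) :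
    ∀ F : MvPolynomial (Fin 3) ℂ, F.IsHomogeneous n → ∃ G : Fin 3 → MvPolynomial (Fin 3) ℂ,
      (∀ m, n = m + 1 → ∀ j, (G j).IsHomogeneous m) ∧ (n = 0 → G = 0) ∧
      F = C (eval u F) * X k ^ n + ∑ j, minorForm u k j * G j := by
  induction n with
  | zero =>
    intro F hF
    rw [← totalDegree_zero_iff_isHomogeneous, totalDegree_eq_zero_iff_eq_C] at hF
    refine ⟨0, by simp, by simp, ?_⟩
    rw [hF]
    simp
  | succ n ih =>
    intro F hF
    have hp (i : Fin 3) : (pderiv i F).IsHomogeneous n := by simpa using hF.pderiv (i := i)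
    choose G hG hG0 hGe using fun i => ih (pderiv i F) (hp i)
    have hn : (n + 1 : ℂ) ≠ 0 := by exact_mod_cast n.succ_ne_zero
    have hX (i j : Fin 3) : (X k * G i j).IsHomogeneous n := by
      cases n with
      | zero => simpa [hG0 i rfl] using isHomogeneous_zero (Fin 3) ℂ 0
      | succ m => exact isHomogeneous_of_eq ((isHomogeneous_X ℂ k).mul (hG i m rfl j)) (add_comm _ _)
    have hm (i : Fin 3) : (X i : MvPolynomial (Fin 3) ℂ) = minorForm u k i + C (u i) * X k := by
      simp [minorForm, hu, smul_eq_C_mul]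
    -- In Euler's relation `(n + 1) F = ∑ X_i ∂_i F`, write `X_i` as a minor form plus `u_i X_k`,
    -- and expand `∂_i F` by induction in the second term.
    refine ⟨fun j => C ((n + 1 : ℂ)⁻¹) * (pderiv j F + ∑ i, C (u i) * (X k * G i j)), ?_, by simp, ?_⟩
    · rintro m hm j
      obtain rfl : n = m := by omega
      exact ((hp j).add (IsHomogeneous.sum _ _ _ fun i _ => (hX i j).C_mul _)).C_mul _
    · have e1 := hF.sum_X_mul_pderiv
      have e2 := congrArg (eval u) e1
      simp only [map_sum, map_mul, eval_X, nsmul_eq_mul, map_natCast] at e2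
      have e3 : C (n + 1 : ℂ) * F = C ((n + 1 : ℂ) * eval u F) * X k ^ (n + 1) +
          ∑ j, minorForm u k j * (pderiv j F + ∑ i, C (u i) * (X k * G i j)) := by
        have e4 : C (n + 1 : ℂ) * F = ∑ i, X i * pderiv i F := by
          rw [e1]
          simp
        have e5 : ∑ i, C (u i) * X k * pderiv i F =
            ∑ i, C (u i) * X k * (C (eval u (pderiv i F)) * X k ^ n + ∑ j, minorForm u k j * G i j) :=
          Finset.sum_congr rfl fun i _ => by rw [← hGe i]
        have e6 : ∑ i, X i * pderiv i F =
            ∑ i, minorForm u k i * pderiv i F + ∑ i, C (u i) * X k * pderiv i F := by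
          rw [← Finset.sum_add_distrib]
          refine Finset.sum_congr rfl fun i _ => ?_
          rw [← add_mul, ← hm]
        rw [e4, e6, e5]
        push_cast at e2
        rw [← e2]
        simp only [Fin.sum_univ_three, map_add, map_mul]
        ring
      have e7 : C ((n + 1 : ℂ)⁻¹) * C (n + 1 : ℂ) = (1 : MvPolynomial (Fin 3) ℂ) := by
        rw [← map_mul, inv_mul_cancel₀ hn, map_one]
      calc F = C ((n + 1 : ℂ)⁻¹) * (C (n + 1 : ℂ) * F) := by rw [← mul_assoc, e7, one_mul]
        _ = (C ((n + 1 : ℂ)⁻¹) * C (n + 1 : ℂ)) * (C (eval u F) * X k ^ (n + 1)) +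
            ∑ j, minorForm u k j * (C ((n + 1 : ℂ)⁻¹) *
              (pderiv j F + ∑ i, C (u i) * (X k * G i j))) := by
          rw [e3]
          simp only [Fin.sum_univ_three, map_mul]
          ring
        _ = _ := by rw [e7, one_mul]

theorem exists_eq_smul {u : Fin 3 → ℂ} {k : Fin 3} (hu : u k = 1)
    {F g : MvPolynomial (Fin 3) ℂ} (hF : F.IsHomogeneous 0) (hg : g.IsHomogeneous 0)
    (h0 : eval u g ≠ 0) : ∃ r : ℂ, F = r • g := by
  obtain ⟨G, -, hG, e⟩ := exists_eq_add_sum_minorForm hu 0 (F - (eval u F / eval u g) • g)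
    (hF.sub (by simpa [smul_eq_C_mul] using hg.C_mul _))
  exact ⟨eval u F / eval u g, by simpa [hG rfl, smul_eval, h0, sub_eq_zero] using e⟩

theorem exists_eq_smul_add {u : Fin 3 → ℂ} {k : Fin 3} (hu : u k = 1) {n : ℕ}
    {F g : MvPolynomial (Fin 3) ℂ} (hF : F.IsHomogeneous (n + 1)) (hg : g.IsHomogeneous (n + 1))
    (h0 : eval u g ≠ 0) : ∃ (r : ℂ) (G : Fin 3 → MvPolynomial (Fin 3) ℂ),
      (∀ j, (G j).IsHomogeneous n) ∧ F = r • g + ∑ j, minorForm u k j * G j := by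
  obtain ⟨G, hG, -, e⟩ := exists_eq_add_sum_minorForm hu (n + 1) (F - (eval u F / eval u g) • g)
    (hF.sub (by simpa only [smul_eq_C_mul] using hg.C_mul _))
  refine ⟨eval u F / eval u g, G, hG n rfl, ?_⟩
  rw [← sub_eq_iff_eq_add', e]
  simp [smul_eval, h0]

/-- Since `f(u) ≠ 0`, its first and second polars at `u` are nonzero at `u` too, as long as the
degree allows. Subtracting multiples of the given forms raises the order of vanishing at `u` from
`0` to `3`, where everything is in `S`. In degrees `1` and `2` the process ends earlier, with
constants. -/
theorem mem_of_polar_mem {u : Fin 3 → ℂ} {k : Fin 3} (hu : u k = 1) {n : ℕ}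
    {f : MvPolynomial (Fin 3) ℂ} (hf : f.IsHomogeneous (n + 1)) (h0 : eval u f ≠ 0)
    {S : Submodule ℂ (MvPolynomial (Fin 3) ℂ)} (hS0 : f ∈ S)
    (hS1 : ∀ j, polar u f * minorForm u k j ∈ S)
    (hS2 : ∀ m, n = m + 1 → ∀ i j, polar u (polar u f) * (minorForm u k i * minorForm u k j) ∈ S)
    (hS3 : ∀ m, n = m + 2 → ∀ i j l G, G.IsHomogeneous m →
      G * (minorForm u k i * minorForm u k j * minorForm u k l) ∈ S)
    {h : MvPolynomial (Fin 3) ℂ} (hh : h.IsHomogeneous (n + 1)) : h ∈ S := by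
  have p1 := polar_isHomogeneous u hf
  have v1 : eval u (polar u f) ≠ 0 := by
    rw [eval_polar hf]
    exact mul_ne_zero (by exact_mod_cast n.succ_ne_zero) h0
  obtain ⟨r, G, hG, rfl⟩ := exists_eq_smul_add hu hh hf h0
  refine S.add_mem (S.smul_mem _ hS0) (S.sum_mem fun j _ => ?_)
  cases n with
  | zero =>
    obtain ⟨s, e⟩ := exists_eq_smul hu (hG j) p1 v1
    rw [e, mul_comm, smul_mul_assoc]
    exact S.smul_mem _ (hS1 j)
  | succ n =>
    have p2 := polar_isHomogeneous u p1
    have v2 : eval u (polar u (polar u f)) ≠ 0 := by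
      rw [eval_polar p1]
      exact mul_ne_zero (by exact_mod_cast n.succ_ne_zero) v1
    obtain ⟨s, G', hG', e⟩ := exists_eq_smul_add hu (hG j) p1 v1
    rw [e, mul_comm, add_mul, smul_mul_assoc, Finset.sum_mul]
    refine S.add_mem (S.smul_mem _ (hS1 j)) (S.sum_mem fun i _ => ?_)
    cases n with
    | zero =>
      obtain ⟨t, e'⟩ := exists_eq_smul hu (hG' i) p2 v2
      have : minorForm u k i * G' i * minorForm u k j =
          t • (polar u (polar u f) * (minorForm u k i * minorForm u k j)) := by
        rw [e', smul_eq_C_mul, smul_eq_C_mul]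
        ring
      rw [this]
      exact S.smul_mem _ (hS2 0 rfl i j)
    | succ n =>
      obtain ⟨t, G'', hG'', e'⟩ := exists_eq_smul_add hu (hG' i) p2 v2
      have : minorForm u k i * G' i * minorForm u k j =
          t • (polar u (polar u f) * (minorForm u k i * minorForm u k j)) +
          ∑ l, G'' l * (minorForm u k i * minorForm u k j * minorForm u k l) := by
        rw [e', smul_eq_C_mul, smul_eq_C_mul, mul_add, add_mul, Finset.mul_sum, Finset.sum_mul]
        refine congrArg₂ (· + ·) (by ring) (Finset.sum_congr rfl fun l _ => by ring)
      rw [this]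
      exact S.add_mem (S.smul_mem _ (hS2 _ rfl i j))
        (S.sum_mem fun l _ => hS3 n rfl i j l _ (hG'' l))

/-! ### Generation -/

/-- The forms which are the components in the direction `c` of vertical equivariant fields at `p`. -/
def verticalForms (e : ℕ) (c : Fin 2) (p : Amb d) : Submodule ℂ (MvPolynomial (Fin 3) ℂ) where
  carrier := {h | ∃ W ∈ equivariantFields d e, ∃ θ, W p = vertical d c (coefs (d c) h) θ}
  zero_mem' := ⟨0, Submodule.zero_mem _, 0, by simp [vertical, Prod.ext_iff]⟩
  add_mem' := by
    rintro h h' ⟨W, hW, θ, e1⟩ ⟨W', hW', θ', e2⟩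
    refine ⟨W + W', Submodule.add_mem _ hW hW', θ + θ', ?_⟩
    simp [e1, e2, vertical, Pi.single_add]
  smul_mem' := by
    rintro r h ⟨W, hW, θ, e1⟩
    refine ⟨r • W, Submodule.smul_mem _ r hW, r • θ, ?_⟩
    simp [e1, vertical, Pi.single_smul]

theorem mem_verticalForms {c : Fin 2} {p : Amb d} {k : Fin 3} (hk : p.1 0 k = 1) {e e' : ℕ}
    (he : e ≤ e') {W : Amb d → Amb d} (hW : W ∈ equivariantFields d e)
    {h : MvPolynomial (Fin 3) ℂ} {θ : Fin 2 → ℂ} (hWp : W p = vertical d c (coefs (d c) h) θ) :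
    h ∈ verticalForms e' c p := by
  have := equivariantFields.mul_pow hW k (e' - e)
  rw [Nat.add_sub_cancel' he] at this
  exact ⟨_, this, θ, by simp [hk, hWp]⟩

theorem mem_verticalForms_of_isHomogeneous (hd : ∀ c, 1 ≤ d c) {χ : Chart d} {p : Amb d}
    (hp : p ∈ slice d χ) {c : Fin 2} (hs : jetVal (form (p.2.1 c)) p.1 ≠ 0)
    {h : MvPolynomial (Fin 3) ℂ} (hh : h.IsHomogeneous (d c)) : h ∈ verticalForms 7 c p := by
  obtain ⟨n, hn⟩ := Nat.exists_eq_add_of_le' (hd c)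
  have hk : p.1 0 χ.1 = 1 := hp.2.1
  refine mem_of_polar_mem hk (isHomogeneous_of_eq (form_isHomogeneous (p.2.1 c)) hn) hs
    (mem_verticalForms hk (Nat.zero_le 7) (euler_mem c) rfl)
    (fun j => mem_verticalForms hk (by norm_num) (polar_field_mem hn χ.1 j) rfl)
    (fun m hm i j => mem_verticalForms hk (by norm_num)
      (polar_polar_field_mem (by omega : d c = m + 2) χ.1 i j) rfl)
    (fun m hm i j l G hG => mem_verticalForms hk (by norm_num)
      (cubic_field_mem (by omega : d c = m + 3) χ.1 i j l (χ.2 c) hG) (θ := 0) ?_)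
    (isHomogeneous_of_eq hh hn)
  simp [hp.2.2.2.2 c]

theorem exists_linear_of_det_ne_zero {z : Jet} (hz : (Matrix.of z).det ≠ 0) (v : Jet) :
    ∃ M : Matrix (Fin 3) (Fin 3) ℂ, ∀ k, M.mulVec (z k) = v k := by
  have hu : IsUnit (Matrix.of z).transpose.det := by simpa using hz
  refine ⟨(Matrix.of v).transpose * (Matrix.of z).transpose⁻¹, fun k => ?_⟩
  have h1 : z k = (Matrix.of z).transpose.mulVec (Pi.single k 1) := by
    funext i
    simp
  rw [h1, Matrix.mulVec_mulVec, Matrix.mul_assoc, Matrix.nonsing_inv_mul _ hu, Matrix.mul_one]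
  funext i
  simp

/-- The linear fields match the jet component of `v`; vertical fields then correct the coefficients
without disturbing it. -/
theorem exists_equivariantField (hd : ∀ c, 1 ≤ d c) {χ : Chart d} {p : Amb d}
    (hp : p ∈ slice d χ) (hs : ∀ c, jetVal (form (p.2.1 c)) p.1 ≠ 0)
    (hdet : (Matrix.of p.1).det ≠ 0) {v : Amb d}
    (hv : ∀ c, fderiv ℂ (eqOne d c) p v = 0 ∧ fderiv ℂ (eqTwo d c) p v = 0) :
    ∃ W ∈ equivariantFields d 7, W p = v := by
  obtain ⟨M, hM⟩ := exists_linear_of_det_ne_zero hdet v.1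
  have hk : p.1 0 χ.1 = 1 := hp.2.1
  have hL := equivariantFields.mul_pow (linearLift_mem hd M) χ.1 7
  rw [zero_add] at hL
  choose V hV θ hVp using fun c => mem_verticalForms_of_isHomogeneous hd hp (hs c)
    (form_isHomogeneous (v.2.1 c - (linearLift d M p).2.1 c))
  have hW := Submodule.add_mem _ hL (Submodule.sum_mem _ fun c (_ : c ∈ Finset.univ) => hV c)
  refine ⟨_, hW, ?_⟩
  set W := (fun p : Amb d => p.1 0 χ.1 ^ 7 • linearLift d M p) + ∑ c, V c with hWdef
  have hWp : W p = linearLift d M p + ∑ c, vertical d c (v.2.1 c - (linearLift d M p).2.1 c) (θ c) := by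
    simp [hWdef, hk, hVp, coefs_form, -Fin.sum_univ_two]
  have w1 : (W p).1 = v.1 := by
    rw [hWp]
    funext k
    simp [vertical, linearLift, hM]
  have w2 : (W p).2.1 = v.2.1 := by
    rw [hWp]
    funext c
    fin_cases c <;> simp [vertical]
  have hWt := hW.2.1 p hp.1
  refine Prod.ext w1 (Prod.ext w2 (funext fun c => ?_))
  -- The difference lives in the `η` directions, so `s` does not vary; both vectors being tangent
  -- and `s ≠ 0`, it vanishes.
  have a1 : HasDerivAt (fun t : ℂ => sectionJet d c (p + t • (W p - v))) 0 0 := by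
    refine (hasDerivAt_const 0 (sectionJet d c p)).congr_of_eventuallyEq
      (Filter.Eventually.of_forall fun t => ?_)
    simp [sectionJet, w1, w2]
  have z1 : fderiv ℂ (eqOne d c) p (W p - v) = 0 := by rw [map_sub, (hWt c).1, (hv c).1, sub_zero]
  have z2 : fderiv ℂ (eqTwo d c) p (W p - v) = 0 := by rw [map_sub, (hWt c).2, (hv c).2, sub_zero]
  have hsc : sectionJet d c p 0 ≠ 0 := hs c
  rw [fderiv_eqOne a1] at z1
  rw [fderiv_eqTwo a1] at z2
  have r0 : (W p - v).2.2 c 0 = 0 := by simpa [hsc] using z1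
  rw [r0] at z2
  have r1 : (W p - v).2.2 c 1 = 0 := by simpa [hsc] using z2
  funext k
  fin_cases k
  · exact sub_eq_zero.1 r0
  · exact sub_eq_zero.1 r1

theorem project_eq_self {χ : Chart d} {p v : Amb d} (hv : v ∈ tangentSpace d χ p) :
    project d χ p v = v := by
  obtain ⟨h1, h2, -⟩ := hv
  refine Prod.ext ?_ (Prod.ext ?_ ?_)
  · funext k
    fin_cases k <;> simp [project, h1]
  · funext c
    simp [project, h2]
  · funext c k
    fin_cases k <;> simp [project, h1, Matrix.vecHead, Matrix.vecTail]

/-! ### The exceptional set -/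

theorem actY_mem {l : Fin 3 → ℂ} (hl : l 0 ≠ 0) {μ : Fin 2 → ℂ} (hμ : ∀ c, μ c ≠ 0) {q : AmbY d}
    (hq : q ∈ coneY d) : actY d l μ q ∈ coneY d := by
  obtain ⟨h0, ha, hA, h⟩ := hq
  refine ⟨?_, fun c => by simpa [actY, hμ c] using ha c, fun c => by simpa [actY, hμ c] using hA c,
    fun c => ?_⟩
  · simpa [actY, scaleJet, hl] using h0
  · obtain ⟨h1, h2, h3⟩ := h c
    have hJ : jets (form ((actY d l μ q).2.2.2.1 c)) (actY d l μ q).1 =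
        μ c • mulJet (powJet l (d c)) (jets (form (q.2.2.2.1 c)) q.1) := by
      simp only [actY, form_smul, jets_smul, scalesBy_form hl _ _]
    have j0 := congrFun hJ 0
    have j1 := congrFun hJ 1
    have j2 := congrFun hJ 2
    simp [jets, mulJet, powJet] at j0 j1 j2
    rw [j0, j1, j2]
    simp [actY, mul_pow, logJet, Matrix.vecHead, Matrix.vecTail]
    refine ⟨?_, ?_, ?_⟩
    · linear_combination μ c * l 0 ^ d c * h1
    · linear_combination μ c * l 0 ^ d c * h2 + μ c * l 0 ^ d c * d c * (l 1 / l 0) * h1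
    · linear_combination μ c * l 0 ^ d c * h3 + 2 * μ c * l 0 ^ d c * d c * (l 1 / l 0) * h2 +
        μ c * l 0 ^ d c * (d c * (l 2 / l 0) + d c * (d c - 1) * (l 1 / l 0) ^ 2) * h1

/-- The lift with `Z_{3+c} = 1` of a jet outside `𝒳`. -/
def liftY (p : Amb d) : AmbY d :=
  (p.1, 1, fun c => (d c : ℂ)⁻¹ • logJet (sectionJet d c p), p.2.1, fun c => - sectionJet d c p 0)

theorem liftY_mem (hd : ∀ c, 1 ≤ d c) {p : Amb d} (ha : ∀ c, p.2.1 c ≠ 0)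
    (hs : ∀ c, sectionJet d c p 0 ≠ 0) : liftY p ∈ coneY d := by
  refine ⟨?_, ha, fun c => neg_ne_zero.2 (hs c), fun c => ?_⟩
  · rintro ⟨-, h⟩
    simpa [liftY] using congrFun h 0
  · have hdc : (d c : ℂ) ≠ 0 := by
      have := hd c
      exact_mod_cast (by omega : d c ≠ 0)
    have hsc := hs c
    have e0 : jetVal (form ((liftY p).2.2.2.1 c)) (liftY p).1 = sectionJet d c p 0 := rfl
    have e1 : jetDer (form ((liftY p).2.2.2.1 c)) (liftY p).1 = sectionJet d c p 1 := rfl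
    have e2 : jetDer2 (form ((liftY p).2.2.2.1 c)) (liftY p).1 = sectionJet d c p 2 := rfl
    rw [e0, e1, e2]
    simp only [liftY, logJet, Pi.one_apply, one_pow, mul_one, Pi.smul_apply, smul_eq_mul,
      mul_inv_cancel_left₀ hdc]
    refine ⟨by ring, ?_, ?_⟩
    · simp
      field_simp
      ring
    · simp
      field_simp
      ring

theorem piAmb_liftY (hd : ∀ c, 1 ≤ d c) {p : Amb d} (hp : p ∈ cone d)
    (hs : ∀ c, sectionJet d c p 0 ≠ 0) : piAmb d (liftY p) = p := by
  refine Prod.ext rfl (Prod.ext rfl (funext fun c => ?_))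
  have hdc : (d c : ℂ) ≠ 0 := by
    have := hd c
    exact_mod_cast (by omega : d c ≠ 0)
  have hsc := hs c
  have e1 : sectionJet d c p 1 = _ := jets_form_one hp c
  have e2 : sectionJet d c p 2 = _ := jets_form_two hp c
  funext k
  fin_cases k
  · simp [piAmb, liftY, logJet, hdc, e1, hsc]
  · simp [piAmb, liftY, logJet, hdc, e1, e2, hsc]

theorem continuousAt_liftY {p : Amb d} (hs : ∀ c, sectionJet d c p 0 ≠ 0) :
    ContinuousAt (liftY : Amb d → AmbY d) p := by
  have hc (c : Fin 2) (k : Fin 3) : ContinuousAt (fun p : Amb d => sectionJet d c p k) p :=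
    ((continuous_apply k).comp (differentiable_sectionJet (d := d) c).continuous).continuousAt
  refine continuousAt_fst.prodMk (continuousAt_const.prodMk (ContinuousAt.prodMk ?_
    (ContinuousAt.prodMk (continuous_fst.comp continuous_snd).continuousAt ?_)))
  · refine continuousAt_pi.2 fun c => continuousAt_pi.2 fun k => ?_
    have q1 := (hc c 1).div₀ (hc c 0) (hs c)
    have q2 := (hc c 2).div₀ (hc c 0) (hs c)
    fin_cases k
    · exact continuousAt_const.mul q1
    · exact continuousAt_const.mul (q2.sub (q1.pow 2))
  · exact continuousAt_pi.2 fun c => (hc c 0).neg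

theorem det_scaleJet (l : Fin 3 → ℂ) (z : Jet) :
    (Matrix.of (scaleJet l z)).det = l 0 ^ 3 * (Matrix.of z).det := by
  simp [Matrix.det_fin_three, scaleJet]
  ring

/-- After rescaling to `Z₀ ≡ 1` the first column of the jet matrix is `(1, 0, 0)`, so its
determinant is the `2 × 2` determinant defining `Σ₀`; rescaling multiplies it by a cube. -/
theorem mk_liftY_mem_sigmaZero {p : Amb d} (hp : liftY p ∈ coneY d) (h0 : p.1 0 0 ≠ 0)
    (hdet : (Matrix.of p.1).det = 0) : Quotient.mk (jetSetoidY d) ⟨liftY p, hp⟩ ∈ sigmaZero d := by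
  have hl : invJet (fun k => p.1 k 0) 0 ≠ 0 := invJet_ne _ h0
  have hμ (c : Fin 2) : (1 : Fin 2 → ℂ) c ≠ 0 := by simp
  have d0 := det_scaleJet (invJet fun k => p.1 k 0) p.1
  have z0 : scaleJet (invJet fun k => p.1 k 0) p.1 0 0 = 1 := by simp [scaleJet, invJet, h0]
  have z1 : scaleJet (invJet fun k => p.1 k 0) p.1 1 0 = 0 := by
    simp [scaleJet, invJet]
    field_simp
    ring
  have z2 : scaleJet (invJet fun k => p.1 k 0) p.1 2 0 = 0 := by
    simp [scaleJet, invJet]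
    field_simp
    ring
  refine ⟨⟨actY d (invJet fun k => p.1 k 0) 1 (liftY p), actY_mem hl hμ hp⟩,
    Quotient.sound ⟨_, hl, 1, hμ, rfl⟩, z0, z1, z2, ?_⟩
  rw [hdet, mul_zero, Matrix.det_fin_three] at d0
  simp only [Matrix.of_apply, z0, z1, z2] at d0
  simp only [actY, liftY]
  linear_combination d0

theorem mem_piTwo_image_sigma (hd : ∀ c, 1 ≤ d c) (p : cone d)
    (hs : ∀ c, jetVal (form (p.1.2.1 c)) p.1.1 ≠ 0) (hdet : (Matrix.of p.1.1).det = 0) :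
    Quotient.mk (jetSetoid d) p ∈ piTwo d hd '' sigma d := by
  have hL := liftY_mem hd p.2.2.1 hs
  refine ⟨Quotient.mk (jetSetoidY d) ⟨liftY p.1, hL⟩, ?_, ?_⟩
  swap
  · change Quotient.mk (jetSetoid d) _ = _
    congr 1
    exact Subtype.ext (piAmb_liftY hd p.2 hs)
  obtain ⟨j, hj⟩ : ∃ j, p.1.1 0 j ≠ 0 := Function.ne_iff.1 p.2.1
  -- Add `ε` times column `j` to column `0`. `P ε` may leave the cone, but `liftY` ignores its `η`
  -- and recomputes the logarithmic derivatives.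
  let P : ℂ → Amb d := fun ε => (fun k => p.1.1 k + Pi.single 0 (ε * p.1.1 k j), p.1.2)
  have hP0 : P 0 = p.1 := by simp [P]
  have hPc : Continuous P := by
    have h1 (k : Fin 3) : Continuous fun ε : ℂ => (Pi.single 0 (ε * p.1.1 k j) : Fin 3 → ℂ) :=
      (continuous_single (0 : Fin 3)).comp (continuous_id.mul continuous_const)
    have h2 : Continuous fun ε : ℂ => fun k => p.1.1 k + Pi.single 0 (ε * p.1.1 k j) :=
      continuous_pi fun k => continuous_const.add (h1 k)
    exact h2.prodMk continuous_const
  have hlim : ContinuousAt (fun ε => liftY (P ε)) 0 :=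
    ContinuousAt.comp (g := liftY) (hP0 ▸ continuousAt_liftY hs) hPc.continuousAt
  refine mem_closure_iff.2 fun U hU hpU => ?_
  have hU' : IsOpen (Quotient.mk (jetSetoidY d) ⁻¹' U) := hU.preimage continuous_quotient_mk'
  obtain ⟨O, hO, hOU⟩ := isOpen_induced_iff.1 hU'
  have hpO : liftY (P 0) ∈ O := by
    have : (⟨liftY p.1, hL⟩ : coneY d) ∈ Subtype.val ⁻¹' O := hOU ▸ hpU
    rw [hP0]
    exact this
  have n1 : ∀ᶠ ε in nhds (0 : ℂ), liftY (P ε) ∈ O := hlim (hO.mem_nhds hpO)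
  have n2 : ∀ᶠ ε in nhds (0 : ℂ), ∀ c, sectionJet d c (P ε) 0 ≠ 0 := by
    refine Filter.eventually_all.2 fun c => ?_
    have h1 : Continuous fun ε => sectionJet d c (P ε) 0 :=
      (continuous_apply 0).comp ((differentiable_sectionJet (d := d) c).continuous.comp hPc)
    refine h1.continuousAt.eventually_ne ?_
    rw [hP0]
    exact hs c
  -- The neighbourhood is punctured because `Z₀(0)` may vanish at `ε = 0`.
  have n3 : ∀ᶠ ε in nhdsWithin (0 : ℂ) {0}ᶜ, (P ε).1 0 0 ≠ 0 := by
    have e (ε : ℂ) : (P ε).1 0 0 = p.1.1 0 0 + ε * p.1.1 0 j := by simp [P]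
    by_cases h0 : p.1.1 0 0 = 0
    · filter_upwards [self_mem_nhdsWithin] with ε hε
      rw [e, h0, zero_add]
      exact mul_ne_zero hε hj
    · have h1 : Continuous fun ε : ℂ => p.1.1 0 0 + ε * p.1.1 0 j := by fun_prop
      refine Filter.Eventually.filter_mono nhdsWithin_le_nhds ?_
      simp only [e]
      exact h1.continuousAt.eventually_ne (by simpa using h0)
  obtain ⟨ε, hε1, hε2, hε3⟩ := ((n1.filter_mono nhdsWithin_le_nhds).and
    ((n2.filter_mono nhdsWithin_le_nhds).and n3)).exists
  have hm : liftY (P ε) ∈ coneY d := liftY_mem hd p.2.2.1 hε2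
  refine ⟨Quotient.mk (jetSetoidY d) ⟨liftY (P ε), hm⟩, ?_, mk_liftY_mem_sigmaZero hm hε3 ?_⟩
  · have : (⟨liftY (P ε), hm⟩ : coneY d) ∈ Subtype.val ⁻¹' O := hε1
    rw [hOU] at this
    exact this
  · rw [Matrix.det_fin_three] at hdet ⊢
    simp only [Matrix.of_apply] at hdet
    simp only [P, Matrix.of_apply, Pi.add_apply]
    -- For `j = 0` the operation scales the column by `1 + ε`; otherwise it preserves the
    -- determinant.
    fin_cases j <;> simp
    · linear_combination (1 + ε) * hdet
    · linear_combination hdet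
    · linear_combination hdet

end LogJets

end

theorem mainTheorem5 (d : Fin 2 → ℕ) (hd : ∀ c, 1 ≤ d c) :
    ∃ m : Fin 2 → ℕ, ∀ x : LogJets.LogJetSpace d,
      x ∉ LogJets.piTwo d hd '' LogJets.sigma d ∪ LogJets.pTwo d ⁻¹' LogJets.universalFamily d →
        LogJets.GeneratedAt d 7 m x := by
  -- No twist along the parameter spaces is needed: the fields are equivariant of weight `0` in `μ`.
  refine ⟨0, fun x hx χ p hp hpx v hv => ?_⟩
  subst hpx
  have hs (c : Fin 2) : LogJets.jetVal (LogJets.form (p.2.1 c)) p.1 ≠ 0 := by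
    intro h
    have hc : LogJets.pTwo d (Quotient.mk (LogJets.jetSetoid d) ⟨p, hp.1⟩) ∈
        LogJets.universalCurve d c :=
      ⟨p.1 0, hp.1.1, p.2.1 c, hp.1.2.1 c, rfl, rfl, h⟩
    refine hx (Or.inr ?_)
    fin_cases c
    · exact Or.inl hc
    · exact Or.inr hc
  have hdet : (Matrix.of p.1).det ≠ 0 := fun h =>
    hx (Or.inl (LogJets.mem_piTwo_image_sigma hd ⟨p, hp.1⟩ hs h))
  obtain ⟨W, hW, hWp⟩ := LogJets.exists_equivariantField hd hp hs hdet hv.2.2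
  refine ⟨LogJets.toTwistedVectorField hW, ?_⟩
  change LogJets.project d χ p (W p) = v
  rw [hWp, LogJets.project_eq_self hv]
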